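/- Let $\mathbb O$ be the octonions with their standard inner product $x\cdot y$, norm $|x|$ and conjugation $C(x)=\bar x$, and let $L_x,R_x$ be left and right multiplication by $x\in\mathbb O$. For $(r,x)\in\mathbb R\oplus\mathbb O$ let $$m_{(r,x)}= i\begin{pmatrix} r\,I_8 & C R_x\\ C L_x & -r\,I_8\end{pmatrix}$$ acting on $\mathbb C\otimes\mathbb O^2$, and let $\mathrm{Spin}(9)\subset \mathrm{GL}_{\mathbb R}(\mathbb O^2)$ be the group generated by the (real) products $m_{(r,x)}m_{(s,y)}$ with $r^2+|x|^2=s^2+|y|^2=1$. Let $H\subset \mathrm{SO}(8)^3$ be the group of triples $(g_1,g_2,g_3)$ of elements of $\mathrm{SO}(\mathbb O)$ with $g_2(xy)=g_1(x)\,g_3(y)$ for all $x,y\in\mathbb O$, and let $K_1\subset\mathrm{GL}_{\mathbb R}(\mathbb O^2)$ be the group of the operators $(x,y)\mapsto(g_1(x),g_3(y))$ with $(g_1,g_2,g_3)\in H$ and $g_1(1)=1$. Put $q(x,y)=|x|^2+|y|^2$ on $\mathbb O^2$ and, for $(v_1,v_2)=((x_1,y_1),(x_2,y_2))\in\mathbb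 O^2\oplus\mathbb O^2$, $$q_{2,0}=|x_1|^2+|y_1|^2,\qquad q_{1,1}=x_1\cdot x_2+y_1\cdot y_2,\qquad q_{0,2}=|x_2|^2+|y_2|^2,$$ $$q_{2,2}=(|x_1|^2-|y_1|^2)(|x_2|^2-|y_2|^2)+4\,(x_1y_1)\cdot(x_2y_2).$$ Then: 1. $\mathrm{Spin}(9)\subset\mathrm{SO}(\mathbb O^2)=\mathrm{SO}(16)$, and $\mathrm{Spin}(9)$ acts transitively on the unit sphere $S^{15}\subset\mathbb O^2$. 2. The algebra of $\mathrm{Spin}(9)$-invariant real polynomials on $\mathbb O^2$ is generated by $q$. 3. The stabilizer of $(1,0)\in\mathbb O^2$ in $\mathrm{Spin}(9)$ is $K_1$, and $K_1$ is isomorphic, as a topological group (hence as a Lie group), to $\mathrm{Spin}(7)$. 4. For the diagonal action of $\mathrm{Spin}(9)$ on $\mathbb O^2\oplus\mathbb O^2$, the generic orbit has codimension $4$: there is a nonzero polynomial $P$ on $\mathbb O^2\oplus\mathbb O^2$ such that the orbit of every $z$ with $P(z)\neq0$ is a smooth embedded submanifold of codimension $4$. 5. The $\mathrm{Spin}(9)$-orbits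 on $\mathbb O^2\oplus\mathbb O^2$ are exactly the (nonempty) simultaneous level sets of $q_{2,0}$, $q_{1,1}$, $q_{0,2}$ and $q_{2,2}$. -/

import Mathlib

open scoped TensorProduct ContDiff

noncomputable section

namespace SpinNine

/-! ### The octonions -/

/-- The octonions as pairs of quaternions (Cayley–Dickson), with the Euclidean inner product. -/
def Oct : Type := WithLp 2 (Quaternion ℝ × Quaternion ℝ)

instance : NormedAddCommGroup Oct :=
  inferInstanceAs (NormedAddCommGroup (WithLp 2 (Quaternion ℝ × Quaternion ℝ)))

instance : InnerProductSpace ℝ Oct :=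
  inferInstanceAs (InnerProductSpace ℝ (WithLp 2 (Quaternion ℝ × Quaternion ℝ)))

namespace Oct

def mk (a b : Quaternion ℝ) : Oct := WithLp.toLp 2 (a, b)

def fst (x : Oct) : Quaternion ℝ := WithLp.fst x

def snd (x : Oct) : Quaternion ℝ := WithLp.snd x

instance : One Oct := ⟨mk 1 0⟩

/-- Octonion multiplication `(a, b) (c, d) = (a c - d̄ b, d a + b c̄)`. -/
instance : Mul Oct :=
  ⟨fun x y => mk (x.fst * y.fst - star y.snd * x.snd) (y.snd * x.fst + x.snd * star y.fst)⟩

@[ext] theorem ext {x y : Oct} (h : x.fst = y.fst) (h' : x.snd = y.snd) : x = y :=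
  WithLp.ofLp_injective 2 (Prod.ext h h')

@[simp] theorem add_fst (x y : Oct) : (x + y).fst = x.fst + y.fst := rfl
@[simp] theorem add_snd (x y : Oct) : (x + y).snd = x.snd + y.snd := rfl
@[simp] theorem smul_fst (r : ℝ) (x : Oct) : (r • x).fst = r • x.fst := rfl
@[simp] theorem smul_snd (r : ℝ) (x : Oct) : (r • x).snd = r • x.snd := rfl
@[simp] theorem mul_fst (x y : Oct) :
    (x * y).fst = x.fst * y.fst - star y.snd * x.snd := rfl
@[simp] theorem mul_snd (x y : Oct) :
    (x * y).snd = y.snd * x.fst + x.snd * star y.fst := rfl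

end Oct

/-- Left multiplication `L_x`. -/
def L (x : Oct) : Oct →ₗ[ℝ] Oct where
  toFun y := x * y
  map_add' y z := by
    ext1 <;> simp only [Oct.mul_fst, Oct.mul_snd, Oct.add_fst, Oct.add_snd, star_add, mul_add,
      add_mul] <;> abel
  map_smul' r y := by ext1 <;> simp [smul_sub, smul_add]

/-- Right multiplication `R_x`. -/
def R (x : Oct) : Oct →ₗ[ℝ] Oct where
  toFun y := y * x
  map_add' y z := by
    ext1 <;> simp only [Oct.mul_fst, Oct.mul_snd, Oct.add_fst, Oct.add_snd, mul_add,
      add_mul] <;> abel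
  map_smul' r y := by ext1 <;> simp [smul_sub, smul_add]

/-- Octonion conjugation `C x = 2 ⟨x, 1⟩ 1 - x`. -/
def C : Oct →ₗ[ℝ] Oct where
  toFun x := (2 * inner ℝ x 1 : ℝ) • (1 : Oct) - x
  map_add' x y := by rw [inner_add_left, mul_add, add_smul]; abel
  map_smul' r x := by
    rw [real_inner_smul_left, RingHom.id_apply, smul_sub, smul_smul]; congr 2; ring

/-! ### The group `Spin(9)` acting on `O²` -/

/-- The space `O²` with its Euclidean structure. -/
def Oct2 : Type := WithLp 2 (Oct × Oct)

instance : NormedAddCommGroup Oct2 :=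
  inferInstanceAs (NormedAddCommGroup (WithLp 2 (Oct × Oct)))

instance : InnerProductSpace ℝ Oct2 :=
  inferInstanceAs (InnerProductSpace ℝ (WithLp 2 (Oct × Oct)))

namespace Oct2

def mk (x y : Oct) : Oct2 := WithLp.toLp 2 (x, y)

def fst (v : Oct2) : Oct := WithLp.fst v

def snd (v : Oct2) : Oct := WithLp.snd v

@[ext] theorem ext {v w : Oct2} (h : v.fst = w.fst) (h' : v.snd = w.snd) : v = w :=
  WithLp.ofLp_injective 2 (Prod.ext h h')

@[simp] theorem mk_fst (x y : Oct) : (mk x y).fst = x := rfl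
@[simp] theorem mk_snd (x y : Oct) : (mk x y).snd = y := rfl
@[simp] theorem add_fst (v w : Oct2) : (v + w).fst = v.fst + w.fst := rfl
@[simp] theorem add_snd (v w : Oct2) : (v + w).snd = v.snd + w.snd := rfl
@[simp] theorem smul_fst (r : ℝ) (v : Oct2) : (r • v).fst = r • v.fst := rfl
@[simp] theorem smul_snd (r : ℝ) (v : Oct2) : (r • v).snd = r • v.snd := rfl

end Oct2

/-- `GL_ℝ(O²)`, with its usual topology. -/
abbrev GLOct2 : Type := (Oct2 →L[ℝ] Oct2)ˣ

/-- The real block matrix `[[r, C R_x], [C L_x, -r]]`. -/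
def blockMap (r : ℝ) (x : Oct) : Oct2 →ₗ[ℝ] Oct2 where
  toFun v := Oct2.mk (r • v.fst + C (R x v.snd)) (C (L x v.fst) - r • v.snd)
  map_add' v w := by
    apply Oct2.ext <;> simp only [Oct2.mk_fst, Oct2.mk_snd, Oct2.add_fst, Oct2.add_snd, map_add,
      smul_add] <;> abel
  map_smul' c v := by
    apply Oct2.ext <;> simp only [Oct2.mk_fst, Oct2.mk_snd, Oct2.smul_fst, Oct2.smul_snd,
      map_smul, smul_add, smul_sub, RingHom.id_apply, smul_comm r c]

/-- Clifford multiplication by `(r, x) ∈ ℝ ⊕ O` on `ℂ ⊗ O²`: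
`m_(r,x) = i [[r, C R_x], [C L_x, -r]]`. -/
def m (r : ℝ) (x : Oct) : ℂ ⊗[ℝ] Oct2 →ₗ[ℂ] ℂ ⊗[ℝ] Oct2 :=
  Complex.I • (blockMap r x).baseChange ℂ

/-- `Spin(9)`: the group generated by the products `m_(r,x) m_(s,y)` of two unit vectors of
`ℝ ⊕ O`. These products are complexifications of real operators, so that the group is a subgroup
of `GL_ℝ(O²)`. -/
def Spin9 : Subgroup GLOct2 :=
  Subgroup.closure {g | ∃ (r : ℝ) (x : Oct) (s : ℝ) (y : Oct),
    r ^ 2 + ‖x‖ ^ 2 = 1 ∧ s ^ 2 + ‖y‖ ^ 2 = 1 ∧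
    ((g : Oct2 →L[ℝ] Oct2) : Oct2 →ₗ[ℝ] Oct2).baseChange ℂ = m r x ∘ₗ m s y}

/-- `SO(O²) = SO(16)`. -/
def SO16 : Subgroup GLOct2 where
  carrier := {g | (∀ v : Oct2, ‖(g : Oct2 →L[ℝ] Oct2) v‖ = ‖v‖) ∧
    LinearMap.det ((g : Oct2 →L[ℝ] Oct2) : Oct2 →ₗ[ℝ] Oct2) = 1}
  one_mem' := ⟨fun _ => rfl, LinearMap.det_id⟩
  mul_mem' := by
    rintro a b ⟨ha, ha'⟩ ⟨hb, hb'⟩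
    refine ⟨fun v => (ha _).trans (hb v), ?_⟩
    have := LinearMap.det_comp ((a : Oct2 →L[ℝ] Oct2) : Oct2 →ₗ[ℝ] Oct2)
      ((b : Oct2 →L[ℝ] Oct2) : Oct2 →ₗ[ℝ] Oct2)
    rw [ha', hb', one_mul] at this
    exact this
  inv_mem' := by
    rintro a ⟨ha, ha'⟩
    have key : ∀ v, (a : Oct2 →L[ℝ] Oct2) ((a⁻¹ : GLOct2).val v) = v := fun v =>
      congrArg (fun f : Oct2 →L[ℝ] Oct2 => f v) a.mul_inv
    refine ⟨fun v => by rw [← ha, key], ?_⟩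
    have := LinearMap.det_comp ((a : Oct2 →L[ℝ] Oct2) : Oct2 →ₗ[ℝ] Oct2)
      (((a⁻¹ : GLOct2) : Oct2 →L[ℝ] Oct2) : Oct2 →ₗ[ℝ] Oct2)
    rw [ha', one_mul] at this
    rw [← this, show ((a : Oct2 →L[ℝ] Oct2) : Oct2 →ₗ[ℝ] Oct2) ∘ₗ
      (((a⁻¹ : GLOct2) : Oct2 →L[ℝ] Oct2) : Oct2 →ₗ[ℝ] Oct2) = LinearMap.id from
        LinearMap.ext key, LinearMap.det_id]

/-! ### The group `K₁` -/

/-- `g` lies in `SO(O) = SO(8)`. -/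
def IsSO8 (g : Oct ≃ₗᵢ[ℝ] Oct) : Prop :=
  LinearMap.det (g.toLinearEquiv : Oct →ₗ[ℝ] Oct) = 1

/-- The group `H` of triples `(g₁, g₂, g₃) ∈ SO(8)³` with `g₂ (x y) = g₁ x · g₃ y`. -/
def H : Subgroup ((Oct ≃ₗᵢ[ℝ] Oct) × (Oct ≃ₗᵢ[ℝ] Oct) × (Oct ≃ₗᵢ[ℝ] Oct)) where
  carrier := {g | IsSO8 g.1 ∧ IsSO8 g.2.1 ∧ IsSO8 g.2.2 ∧
    ∀ x y : Oct, g.2.1 (x * y) = g.1 x * g.2.2 y}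
  one_mem' := ⟨LinearMap.det_id, LinearMap.det_id, LinearMap.det_id, fun _ _ => rfl⟩
  mul_mem' := by
    have key : ∀ a b : Oct ≃ₗᵢ[ℝ] Oct, IsSO8 a → IsSO8 b → IsSO8 (a * b) := by
      intro a b ha hb
      have := LinearMap.det_comp (a.toLinearEquiv : Oct →ₗ[ℝ] Oct)
        (b.toLinearEquiv : Oct →ₗ[ℝ] Oct)
      rw [show LinearMap.det (a.toLinearEquiv : Oct →ₗ[ℝ] Oct) = 1 from ha,
        show LinearMap.det (b.toLinearEquiv : Oct →ₗ[ℝ] Oct) = 1 from hb, one_mul] at this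
      exact this
    rintro a b ⟨ha1, ha2, ha3, ha⟩ ⟨hb1, hb2, hb3, hb⟩
    refine ⟨key _ _ ha1 hb1, key _ _ ha2 hb2, key _ _ ha3 hb3, fun x y => ?_⟩
    change a.2.1 (b.2.1 (x * y)) = a.1 (b.1 x) * a.2.2 (b.2.2 y)
    rw [hb, ha]
  inv_mem' := by
    have key : ∀ a : Oct ≃ₗᵢ[ℝ] Oct, IsSO8 a → IsSO8 a⁻¹ := by
      intro a ha
      have := LinearMap.det_comp (a.toLinearEquiv : Oct →ₗ[ℝ] Oct)
        ((a⁻¹).toLinearEquiv : Oct →ₗ[ℝ] Oct)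
      rw [show LinearMap.det (a.toLinearEquiv : Oct →ₗ[ℝ] Oct) = 1 from ha, one_mul,
        show (a.toLinearEquiv : Oct →ₗ[ℝ] Oct) ∘ₗ ((a⁻¹).toLinearEquiv : Oct →ₗ[ℝ] Oct)
          = LinearMap.id from LinearMap.ext a.apply_symm_apply, LinearMap.det_id] at this
      exact this.symm
    rintro a ⟨ha1, ha2, ha3, ha⟩
    refine ⟨key _ ha1, key _ ha2, key _ ha3, fun x y => ?_⟩
    change a.2.1.symm (x * y) = a.1.symm x * a.2.2.symm y
    rw [LinearIsometryEquiv.symm_apply_eq, ha]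
    simp only [LinearIsometryEquiv.apply_symm_apply]

/-- `K₁`: the triples of `H` with `g₁ 1 = 1`, regarded as the operators
`(x, y) ↦ (g₁ x, g₃ y)` of `O²`. -/
def K1 : Subgroup GLOct2 where
  carrier := {g | ∃ h ∈ H, h.1 1 = 1 ∧
    ∀ v : Oct2, (g : Oct2 →L[ℝ] Oct2) v = Oct2.mk (h.1 v.fst) (h.2.2 v.snd)}
  one_mem' := ⟨1, one_mem _, rfl, fun _ => rfl⟩
  mul_mem' := by
    rintro a b ⟨h, hh, h1, ha⟩ ⟨k, hk, k1, hb⟩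
    refine ⟨h * k, mul_mem hh hk, ?_, fun v => ?_⟩
    · change h.1 (k.1 1) = 1
      rw [k1, h1]
    · change (a : Oct2 →L[ℝ] Oct2) ((b : Oct2 →L[ℝ] Oct2) v) = _
      rw [hb, ha]
      rfl
  inv_mem' := by
    rintro a ⟨h, hh, h1, ha⟩
    refine ⟨h⁻¹, inv_mem hh, ?_, fun v => ?_⟩
    · change h.1.symm 1 = 1
      rw [LinearIsometryEquiv.symm_apply_eq, h1]
    · have hv : v = (a : Oct2 →L[ℝ] Oct2)
          (Oct2.mk (h.1.symm v.fst) (h.2.2.symm v.snd)) := by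
        rw [ha]
        exact Oct2.ext (h.1.apply_symm_apply v.fst).symm (h.2.2.apply_symm_apply v.snd).symm
      have key : ∀ w, (a⁻¹ : GLOct2).val ((a : Oct2 →L[ℝ] Oct2) w) = w := fun w =>
        congrArg (fun f : Oct2 →L[ℝ] Oct2 => f w) a.inv_mul
      conv_lhs => rw [hv]
      rw [key]
      rfl

/-! ### The abstract group `Spin(7)` -/

/-- The quadratic form `-|x|²` on `ℝ⁷`, so that `v² = -|v|²` in its Clifford algebra. -/
def Q7 : QuadraticForm ℝ (EuclideanSpace ℝ (Fin 7)) :=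
  -LinearMap.BilinMap.toQuadraticMap (innerₗ (EuclideanSpace ℝ (Fin 7)))

/-- The usual topology of the finite-dimensional real vector space `Cℓ(ℝ⁷)`. -/
instance : TopologicalSpace (CliffordAlgebra Q7) := moduleTopology ℝ _

/-- `Spin(7)`, with the topology of a subset of the Clifford algebra. -/
abbrev Spin7 : Submonoid (CliffordAlgebra Q7) := spinGroup Q7

/-! ### Invariant polynomials and submanifolds -/

/-- The algebra of real polynomial functions on a real vector space: the one generated by the
linear functionals. -/
def polyFun (V : Type) [AddCommGroup V] [Module ℝ V] : Subalgebra ℝ (V → ℝ) :=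
  Algebra.adjoin ℝ (Set.range fun l : V →ₗ[ℝ] ℝ => (l : V → ℝ))

/-- The `Spin(9)`-invariant polynomial functions on `O²`. -/
def invPoly : Subalgebra ℝ (Oct2 → ℝ) where
  carrier := {f | f ∈ polyFun Oct2 ∧ ∀ (g : Spin9) (v : Oct2), f (g • v) = f v}
  mul_mem' := fun ha hb => ⟨mul_mem ha.1 hb.1, fun g v => by
    simp only [Pi.mul_apply, ha.2 g v, hb.2 g v]⟩
  add_mem' := fun ha hb => ⟨add_mem ha.1 hb.1, fun g v => by
    simp only [Pi.add_apply, ha.2 g v, hb.2 g v]⟩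
  algebraMap_mem' := fun r => ⟨Subalgebra.algebraMap_mem _ r, fun _ _ => rfl⟩

/-- `S` is a smooth embedded submanifold of codimension `k` of the normed space `E`: near each of
its points it is the zero set of a smooth submersion to `ℝᵏ`. -/
def IsSubmanifoldOfCodim {E : Type} [NormedAddCommGroup E] [NormedSpace ℝ E] (k : ℕ)
    (S : Set E) : Prop :=
  ∀ p ∈ S, ∃ (U : Set E) (f : E → EuclideanSpace ℝ (Fin k)), IsOpen U ∧ p ∈ U ∧
    ContDiffOn ℝ ∞ f U ∧ (∀ x ∈ U, Function.Surjective (fderiv ℝ f x)) ∧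
    S ∩ U = {x ∈ U | f x = 0}

/-! ### The polynomials -/

/-- `q (x, y) = |x|² + |y|²`. -/
def q (v : Oct2) : ℝ := ‖v.fst‖ ^ 2 + ‖v.snd‖ ^ 2

/-- The squaring map `σ (x, y) = (|x|² - |y|², 2 x y)` to `ℝ ⊕ O`. -/
def σ (v : Oct2) : WithLp 2 (ℝ × Oct) :=
  WithLp.toLp 2 (‖v.fst‖ ^ 2 - ‖v.snd‖ ^ 2, (2 : ℝ) • (v.fst * v.snd))

def q20 (z : Oct2 × Oct2) : ℝ := ‖z.1.fst‖ ^ 2 + ‖z.1.snd‖ ^ 2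

def q11 (z : Oct2 × Oct2) : ℝ := inner ℝ z.1.fst z.2.fst + inner ℝ z.1.snd z.2.snd

def q02 (z : Oct2 × Oct2) : ℝ := ‖z.2.fst‖ ^ 2 + ‖z.2.snd‖ ^ 2

def q22 (z : Oct2 × Oct2) : ℝ := inner ℝ (σ z.1) (σ z.2)

end SpinNine

end

/-!
For `w ∈ ℝ ⊕ O` let `T w` be the Clifford operator `clifford w` on `O²`. It satisfies
`⟨T w v, v⟩ = ⟨w, σ v⟩` for the squaring map `σ`, and conjugation by `T w` with `‖w‖ = 1` covers,
through `σ`, minus the reflection in `w`. As every rotation of `ℝ ⊕ O` is a product of an even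
number of reflections and the maps `g` with `σ (g v) = σ v` for all `v` are `±1`, the group
`Spin(9)` consists of all `g` with `σ (g v) = ρ (σ v)` for some `ρ ∈ SO(9)`. If `x ≠ 0`, then
`T (|x|², x y)` sends `(x, y)` to a vector with second coordinate `0`, whence the transitivity on
spheres.

A `g ∈ Spin(9)` that fixes `(1, 0)` covers a rotation fixing the pole of `ℝ ⊕ O`, hence is block
diagonal, and then `σ (g v) = ρ (σ v)` says that its blocks satisfy `g₃ (a b) = g₁ a * g₃ b`. For an
imaginary unit `e`, left multiplication by `e` is such a `g₃` for the rotation `a ↦ e a e⁻¹`, so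
writing `g₁` as an even product of reflections shows that every `g₃` is an even product of such left
multiplications, at most eight of them. The same words in the Clifford algebra of `ℝ⁷` make up
`Spin(7)`, which acts faithfully because a Clifford element all of whose contractions vanish is a
scalar; being a union of finitely many sets of words of bounded length, it is compact, so the
continuous bijection `Spin(7) → K₁` is a homeomorphism.

For two vectors, one moves the first to `(t, 0)` and the second into a fixed slice by `K₁`, which is
transitive on the pairs with given norms and real part. The four invariants have an explicit smooth
section there, so they are independent wherever a polynomial discriminant does not vanish.
-/

noncomputable section

namespace SpinNine

open Module Metric

/-! ### Determinants and isometries -/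

/-- If `J² = -1`, then `(1 + J)² = 2 J` forces `det J ≥ 0`, while `(det J)² = ± 1`. -/
theorem det_eq_one_of_mul_self_eq_neg_one {K V : Type*} [Field K] [LinearOrder K]
    [IsStrictOrderedRing K] [AddCommGroup V] [Module K V] {J : Module.End K V}
    (hJ : J * J = -1) : LinearMap.det J = 1 := by
  have hsq : LinearMap.det J ^ 2 = (-1) ^ finrank K V := by
    rw [sq, ← map_mul, hJ, ← neg_one_smul K (1 : Module.End K V), LinearMap.det_smul, map_one,
      mul_one]
  have hdouble : 2 ^ finrank K V * LinearMap.det J = LinearMap.det (1 + J) ^ 2 := by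
    rw [sq, ← map_mul, ← LinearMap.det_smul]
    congr 1
    rw [mul_add, mul_one, add_mul, one_mul, hJ, two_smul]
    abel
  have hnonneg : 0 ≤ LinearMap.det J :=
    nonneg_of_mul_nonneg_right (hdouble ▸ sq_nonneg _) (by positivity)
  have hone : LinearMap.det J ^ 2 = 1 := by
    rcases neg_one_pow_eq_or K (finrank K V) with h | h
    · rw [hsq, h]
    · linarith [sq_nonneg (LinearMap.det J)]
  exact (pow_eq_one_iff_of_nonneg hnonneg two_ne_zero).1 hone

theorem prod_map_mul_left_of_commute {M ι : Type*} [Monoid M] {c : M} {f : ι → M}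
    (h : ∀ i, Commute c (f i)) (l : List ι) :
    (l.map fun i => c * f i).prod = c ^ l.length * (l.map f).prod := by
  induction l with
  | nil => simp
  | cons i l ih =>
    rw [List.map_cons, List.prod_cons, List.map_cons, List.prod_cons, ih, List.length_cons,
      pow_succ', mul_assoc, mul_assoc, ← mul_assoc (f i), ← ((h i).pow_left l.length).eq, mul_assoc]

section InnerProductSpace

variable {E F : Type*} [NormedAddCommGroup E] [InnerProductSpace ℝ E]
  [NormedAddCommGroup F] [InnerProductSpace ℝ F]

theorem norm_eq_of_inner_self_eq {v : E} {w : F} (h : inner ℝ v v = inner ℝ w w) :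
    ‖v‖ = ‖w‖ := by
  rw [norm_eq_sqrt_real_inner, norm_eq_sqrt_real_inner, h]

theorem inner_map_map_of_norm_map (f : E →ₗ[ℝ] F) (hf : ∀ v, ‖f v‖ = ‖v‖) (v w : E) :
    inner ℝ (f v) (f w) = inner ℝ v w :=
  (⟨f, hf⟩ : E →ₗᵢ[ℝ] F).inner_map_map v w

/-- The determinant of a linear isometry. -/
def isometryDet : (E ≃ₗᵢ[ℝ] E) →* ℝ where
  toFun g := LinearMap.det (g.toLinearEquiv : E →ₗ[ℝ] E)
  map_one' := LinearMap.det_id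
  map_mul' g h := LinearMap.det_comp (g.toLinearEquiv : E →ₗ[ℝ] E) (h.toLinearEquiv : E →ₗ[ℝ] E)

/-- The reflection in the hyperplane orthogonal to the unit vector `u`. -/
def unitReflection (u : sphere (0 : E) 1) : E ≃ₗᵢ[ℝ] E := (ℝ ∙ (u : E))ᗮ.reflection

theorem unitReflection_apply (u : sphere (0 : E) 1) (v : E) :
    unitReflection u v = v - (2 * inner ℝ (u : E) v : ℝ) • (u : E) := by
  rw [unitReflection, Submodule.reflection_orthogonal_apply, Submodule.reflection_singleton_apply]
  simp [mul_smul, two_smul]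

/-- A unit vector of a subspace, as a unit vector of the ambient space. -/
def sphereInclusion (K : Submodule ℝ E) (u : sphere (0 : K) 1) : sphere (0 : E) 1 :=
  ⟨u, by rw [mem_sphere_zero_iff_norm]; exact norm_eq_of_mem_sphere u⟩

theorem prod_unitReflection_sphereInclusion_apply {K : Submodule ℝ E} (l : List (sphere (0 : Kᗮ) 1))
    (x : K) (y : Kᗮ) :
    (l.map fun u => unitReflection (sphereInclusion Kᗮ u)).prod ((x : E) + y) =
      x + (l.map unitReflection).prod y := by
  induction l with
  | nil => rfl
  | cons u l ih =>
    have hux : inner ℝ (u : E) (x : E) = 0 := Submodule.inner_left_of_mem_orthogonal x.2 u.1.2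
    rw [List.map_cons, List.prod_cons, List.map_cons, List.prod_cons, LinearIsometryEquiv.coe_mul,
      LinearIsometryEquiv.coe_mul, Function.comp_apply, Function.comp_apply, ih,
      unitReflection_apply, unitReflection_apply, inner_add_right]
    simp [sphereInclusion, hux, add_sub_assoc]

variable [FiniteDimensional ℝ E]

theorem exists_unit_orthogonal {ι : Type*} [Fintype ι] (v : ι → E)
    (h : Fintype.card ι < finrank ℝ E) : ∃ u : sphere (0 : E) 1, ∀ i, inner ℝ (v i) u = 0 := by
  have hspan : Submodule.span ℝ (Set.range v) ≠ ⊤ := fun htop =>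
    ((finrank_range_le_card v).trans_lt h).ne (by rw [Set.finrank, htop, finrank_top])
  obtain ⟨u, hu, hu0⟩ := Submodule.exists_mem_ne_zero_of_ne_bot
    (mt Submodule.orthogonal_eq_bot_iff.1 hspan)
  refine ⟨⟨‖u‖⁻¹ • u, by simp [norm_smul, hu0]⟩, fun i => ?_⟩
  have hvu : inner ℝ (v i) u = 0 :=
    (Submodule.mem_orthogonal _ _).1 hu _ (Submodule.subset_span (Set.mem_range_self i))
  rw [real_inner_smul_right, hvu, mul_zero]

/-- The isometry given by a norm-preserving endomorphism of a finite-dimensional space. -/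
def isometryOfNormMap (f : E →ₗ[ℝ] E) (hf : ∀ v, ‖f v‖ = ‖v‖) : E ≃ₗᵢ[ℝ] E :=
  (⟨f, hf⟩ : E →ₗᵢ[ℝ] E).toLinearIsometryEquiv rfl

theorem isometryDet_unitReflection (u : sphere (0 : E) 1) :
    isometryDet (unitReflection u) = -1 := by
  refine (ℝ ∙ (u : E))ᗮ.det_reflection.trans ?_
  rw [Submodule.orthogonal_orthogonal, finrank_span_singleton (ne_zero_of_mem_unit_sphere u),
    pow_one]

theorem isometryDet_prod_unitReflection (l : List (sphere (0 : E) 1)) :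
    isometryDet (l.map unitReflection).prod = (-1) ^ l.length := by
  rw [map_list_prod, List.map_map, ← List.prod_replicate]
  exact congrArg List.prod (List.map_eq_replicate_iff.2 fun u _ => isometryDet_unitReflection u)

theorem exists_prod_unitReflection (φ : E ≃ₗᵢ[ℝ] E) :
    ∃ l : List (sphere (0 : E) 1), l.length ≤ finrank ℝ E ∧ φ = (l.map unitReflection).prod := by
  suffices h : ∀ l : List E, ∃ l' : List (sphere (0 : E) 1), l'.length ≤ l.length ∧
      (l.map fun v => (ℝ ∙ v)ᗮ.reflection).prod = (l'.map unitReflection).prod by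
    obtain ⟨l, hlen, hφ⟩ := φ.reflections_generate_dim
    obtain ⟨l', hlen', hl'⟩ := h l
    exact ⟨l', hlen'.trans hlen, hφ.trans hl'⟩
  intro l
  induction l with
  | nil => exact ⟨[], le_rfl, rfl⟩
  | cons v l ih =>
    obtain ⟨l', hlen, hl'⟩ := ih
    by_cases hv : v = 0
    · refine ⟨l', hlen.trans (Nat.le_succ _), ?_⟩
      rw [List.map_cons, List.prod_cons, hl', hv]
      convert one_mul (l'.map unitReflection).prod
      ext w
      exact Submodule.reflection_mem_subspace_eq_self (by simp)
    · refine ⟨⟨‖v‖⁻¹ • v, by simp [norm_smul, hv]⟩ :: l', Nat.succ_le_succ hlen, ?_⟩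
      have hspan : (ℝ ∙ ‖v‖⁻¹ • v) = ℝ ∙ v :=
        Submodule.span_singleton_smul_eq (IsUnit.mk0 _ (by simpa using hv)) v
      rw [List.map_cons, List.prod_cons, List.map_cons, List.prod_cons, hl']
      simp only [unitReflection, hspan]

theorem exists_prod_unitReflection_of_fixes {K : Submodule ℝ E} {φ : E ≃ₗᵢ[ℝ] E}
    (hφ : ∀ x ∈ K, φ x = x) : ∃ l : List (sphere (0 : Kᗮ) 1), l.length ≤ finrank ℝ Kᗮ ∧
      φ = (l.map fun u => unitReflection (sphereInclusion Kᗮ u)).prod := by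
  have hmem : ∀ y ∈ Kᗮ, φ y ∈ Kᗮ := fun y hy => (K.mem_orthogonal _).2 fun x hx => by
    rw [← hφ x hx, φ.inner_map_map, Submodule.inner_right_of_mem_orthogonal hx hy]
  obtain ⟨l, hlen, hl⟩ := exists_prod_unitReflection (isometryOfNormMap
    ((φ.toLinearEquiv : E →ₗ[ℝ] E).restrict hmem) fun y => φ.norm_map y)
  refine ⟨l, hlen, LinearIsometryEquiv.ext fun z => ?_⟩
  obtain ⟨x, hx, y, hy, rfl⟩ := Submodule.exists_add_mem_mem_orthogonal (K := K) z
  rw [prod_unitReflection_sphereInclusion_apply l ⟨x, hx⟩ ⟨y, hy⟩, ← hl, map_add, hφ x hx]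
  rfl

theorem isometryDet_withLpProdCongr [FiniteDimensional ℝ F] (f : E ≃ₗᵢ[ℝ] E) (g : F ≃ₗᵢ[ℝ] F) :
    isometryDet (f.withLpProdCongr 2 g) = isometryDet f * isometryDet g :=
  (LinearMap.det_conj _ (WithLp.linearEquiv 2 ℝ (E × F)).symm).trans
    (LinearMap.det_prodMap (f.toLinearEquiv : E →ₗ[ℝ] E) (g.toLinearEquiv : F →ₗ[ℝ] F))

end InnerProductSpace

/-! ### Polynomial functions -/

section Polynomial

variable {V W W' W'' : Type} [AddCommGroup V] [Module ℝ V] [AddCommGroup W] [Module ℝ W]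
  [AddCommGroup W'] [Module ℝ W'] [AddCommGroup W''] [Module ℝ W'']

/-- A map between real vector spaces is polynomial if its composition with every linear functional
is a polynomial function. -/
def IsPolyMap (F : V → W) : Prop :=
  ∀ l : W →ₗ[ℝ] ℝ, (fun z => l (F z)) ∈ polyFun V

theorem isPolyMap_linearMap (F : V →ₗ[ℝ] W) : IsPolyMap F :=
  fun l => Algebra.subset_adjoin ⟨l ∘ₗ F, rfl⟩

theorem IsPolyMap.mem_polyFun {f : V → ℝ} (hf : IsPolyMap f) : f ∈ polyFun V :=
  hf LinearMap.id

theorem IsPolyMap.bilin [FiniteDimensional ℝ W] {F : V → W} {G : V → W'} (hF : IsPolyMap F)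
    (hG : IsPolyMap G) (B : W →ₗ[ℝ] W' →ₗ[ℝ] W'') : IsPolyMap fun z => B (F z) (G z) := by
  intro l
  let b := finBasis ℝ W
  have hsum : (fun z => l (B (F z) (G z))) =
      ∑ i, (fun z => b.coord i (F z)) * fun z => (l ∘ₗ B (b i)) (G z) := by
    ext z
    conv_lhs => rw [← b.sum_repr (F z)]
    simp only [map_sum, map_smul, LinearMap.sum_apply, LinearMap.smul_apply, smul_eq_mul,
      Finset.sum_apply, Pi.mul_apply, LinearMap.comp_apply, Basis.coord_apply]
  rw [hsum]
  exact sum_mem fun i _ => mul_mem (hF _) (hG _)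

theorem exists_eval_eq_of_mem_polyFun {f : V → ℝ} (hf : f ∈ polyFun V) (v : V) :
    ∃ p : Polynomial ℝ, ∀ t : ℝ, f (t • v) = p.eval t := by
  induction hf using Algebra.adjoin_induction with
  | mem f hf =>
    obtain ⟨l, rfl⟩ := hf
    exact ⟨Polynomial.C (l v) * Polynomial.X, fun t => by
      rw [Polynomial.eval_mul_X, Polynomial.eval_C, mul_comm]
      exact l.map_smul t v⟩
  | algebraMap r => exact ⟨Polynomial.C r, fun t => by simp⟩
  | add f g _ _ hf hg =>
    obtain ⟨p, hp⟩ := hf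
    obtain ⟨r, hr⟩ := hg
    exact ⟨p + r, fun t => by simp [hp, hr]⟩
  | mul f g _ _ hf hg =>
    obtain ⟨p, hp⟩ := hf
    obtain ⟨r, hr⟩ := hg
    exact ⟨p * r, fun t => by simp [hp, hr]⟩

theorem contDiff_of_mem_polyFun {E : Type} [NormedAddCommGroup E] [NormedSpace ℝ E]
    [FiniteDimensional ℝ E] {f : E → ℝ} (hf : f ∈ polyFun E) {n : WithTop ℕ∞} :
    ContDiff ℝ n f := by
  induction hf using Algebra.adjoin_induction with
  | mem f hf =>
    obtain ⟨l, rfl⟩ := hf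
    exact l.toContinuousLinearMap.contDiff
  | algebraMap r => exact contDiff_const
  | add f g _ _ hf hg => exact hf.add hg
  | mul f g _ _ hf hg => exact hf.mul hg

theorem exists_eval_add_eval_neg_eq_eval_sq {S : Type*} [CommRing S] (p : Polynomial S) :
    ∃ r : Polynomial S, ∀ t : S, p.eval t + p.eval (-t) = r.eval (t ^ 2) := by
  induction p using Polynomial.induction_on' with
  | add p p' hp hp' =>
    obtain ⟨r, hr⟩ := hp
    obtain ⟨r', hr'⟩ := hp'
    exact ⟨r + r', fun t => by simp only [Polynomial.eval_add, ← hr, ← hr']; ring⟩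
  | monomial n a =>
    rcases n.even_or_odd' with ⟨k, rfl | rfl⟩
    · refine ⟨Polynomial.monomial k (2 * a), fun t => ?_⟩
      simp only [Polynomial.eval_monomial, pow_mul, neg_sq]
      ring
    · exact ⟨0, fun t => by simp [Polynomial.eval_monomial, (odd_two_mul_add_one k).neg_pow]⟩

end Polynomial

/-! ### Scalars in a Clifford algebra -/

section Scalars

open CliffordAlgebra

variable {S M κ : Type*} [CommRing S] [AddCommGroup M] [Module S M]

theorem contractLeft_polarBilin {Q : QuadraticForm S M} (v : M) (x : CliffordAlgebra Q) :
    contractLeft (Q.polarBilin v) x = ι Q v * x - involute x * ι Q v := by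
  induction x using CliffordAlgebra.left_induction with
  | algebraMap r => simp [Algebra.commutes]
  | add x y hx hy => rw [map_add, hx, hy, map_add, mul_add, add_mul]; abel
  | ι_mul x w hx =>
    have hswap := congrArg (· * x) (ι_mul_ι_add_swap (Q := Q) v w)
    simp only [add_mul, mul_assoc] at hswap
    rw [contractLeft_ι_mul, hx, map_mul, involute_ι, Algebra.smul_def,
      QuadraticMap.polarBilin_apply_apply, ← hswap]
    noncomm_ring

theorem ι_zero_mul_ι_zero_mul (v w : M) (x : CliffordAlgebra (0 : QuadraticForm S M)) :
    ι (0 : QuadraticForm S M) v * (ι 0 w * x) = -(ι 0 w * (ι 0 v * x)) := by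
  have hswap := ι_mul_ι_add_swap (Q := (0 : QuadraticForm S M)) v w
  rw [show QuadraticMap.polar (0 : QuadraticForm S M) v w = 0 by simp [QuadraticMap.polar],
    map_zero] at hswap
  rw [← mul_assoc, eq_neg_of_add_eq_zero_left hswap, neg_mul, mul_assoc]

variable (b : Basis κ S M)

/-- The projection of the exterior algebra of `M`, encoded as the Clifford algebra of the zero form,
onto the span of the monomials that do not involve the basis vector `b i`. -/
def basisProj (i : κ) : Module.End S (CliffordAlgebra (0 : QuadraticForm S M)) :=
  LinearMap.id - LinearMap.mulLeft S (ι 0 (b i)) ∘ₗ contractLeft (b.coord i)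

theorem basisProj_apply (i : κ) (x : CliffordAlgebra (0 : QuadraticForm S M)) :
    basisProj b i x = x - ι 0 (b i) * contractLeft (b.coord i) x := rfl

theorem basisProj_ι_mul_self (i : κ) (x : CliffordAlgebra (0 : QuadraticForm S M)) :
    basisProj b i (ι 0 (b i) * x) = 0 := by
  rw [basisProj_apply, contractLeft_ι_mul, mul_sub, ← mul_assoc (ι 0 (b i)) (ι 0 (b i)),
    ι_sq_scalar]
  simp

theorem basisProj_ι_mul {i j : κ} (h : j ≠ i) (x : CliffordAlgebra (0 : QuadraticForm S M)) :
    basisProj b j (ι 0 (b i) * x) = ι 0 (b i) * basisProj b j x := by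
  rw [basisProj_apply, basisProj_apply, contractLeft_ι_mul, mul_sub, mul_sub,
    ι_zero_mul_ι_zero_mul]
  simp [h.symm]

theorem prod_basisProj_ι_mul {l : List κ} {i : κ} (hi : i ∈ l)
    (x : CliffordAlgebra (0 : QuadraticForm S M)) :
    (l.map (basisProj b)).prod (ι 0 (b i) * x) = 0 := by
  induction l using List.reverseRecOn generalizing x with
  | nil => simp at hi
  | append_singleton l j ih =>
    rw [List.map_append, List.prod_append, List.map_singleton, List.prod_singleton,
      Module.End.mul_apply]
    by_cases hji : j = i
    · rw [hji, basisProj_ι_mul_self, map_zero]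
    · rw [basisProj_ι_mul b hji]
      exact ih (by simpa [Ne.symm hji] using hi) _

theorem prod_basisProj_of_contractLeft_eq_zero (l : List κ)
    {x : CliffordAlgebra (0 : QuadraticForm S M)} (hx : ∀ i, contractLeft (b.coord i) x = 0) :
    (l.map (basisProj b)).prod x = x := by
  induction l with
  | nil => rfl
  | cons i l ih =>
    rw [List.map_cons, List.prod_cons, Module.End.mul_apply, ih, basisProj_apply, hx, mul_zero,
      sub_zero]

theorem exists_prod_basisProj_eq_algebraMap [Fintype κ]
    (x : CliffordAlgebra (0 : QuadraticForm S M)) :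
    ∃ r : S, (Finset.univ.toList.map (basisProj b)).prod x = algebraMap S _ r := by
  induction x using CliffordAlgebra.left_induction with
  | algebraMap r =>
    exact ⟨r, prod_basisProj_of_contractLeft_eq_zero b _ fun i => contractLeft_algebraMap _ _ r⟩
  | add x y hx hy =>
    obtain ⟨r, hr⟩ := hx
    obtain ⟨s, hs⟩ := hy
    exact ⟨r + s, by rw [map_add, hr, hs, map_add]⟩
  | ι_mul x v _ =>
    refine ⟨0, ?_⟩
    rw [← b.sum_repr v, map_sum, Finset.sum_mul, map_sum, map_zero]
    refine Finset.sum_eq_zero fun i _ => ?_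
    rw [map_smul, smul_mul_assoc, map_smul, prod_basisProj_ι_mul b (by simp), smul_zero]

theorem exists_eq_algebraMap_of_contractLeft_eq_zero [Finite κ] [Invertible (2 : S)]
    {Q : QuadraticForm S M} {x : CliffordAlgebra Q} (hx : ∀ i, contractLeft (b.coord i) x = 0) :
    ∃ r : S, x = algebraMap S (CliffordAlgebra Q) r := by
  cases nonempty_fintype κ
  have hQ := changeForm.associated_neg_proof (Q := Q)
  obtain ⟨r, hr⟩ := exists_prod_basisProj_eq_algebraMap b (changeForm hQ x)
  rw [prod_basisProj_of_contractLeft_eq_zero b _ fun i => by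
    rw [← changeForm_contractLeft, hx, map_zero]] at hr
  refine ⟨r, (changeFormEquiv hQ).injective ?_⟩
  rw [changeFormEquiv_apply, changeFormEquiv_apply, hr, changeForm_algebraMap]

end Scalars

/-! ### Octonion identities -/

open scoped Quaternion

namespace Oct

@[simp] theorem mk_fst (a b : ℍ[ℝ]) : (mk a b).fst = a := rfl
@[simp] theorem mk_snd (a b : ℍ[ℝ]) : (mk a b).snd = b := rfl
@[simp] theorem one_fst : (1 : Oct).fst = 1 := rfl
@[simp] theorem one_snd : (1 : Oct).snd = 0 := rfl
@[simp] theorem zero_fst : (0 : Oct).fst = 0 := rfl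
@[simp] theorem zero_snd : (0 : Oct).snd = 0 := rfl
@[simp] theorem neg_fst (x : Oct) : (-x).fst = -x.fst := rfl
@[simp] theorem neg_snd (x : Oct) : (-x).snd = -x.snd := rfl
@[simp] theorem sub_fst (x y : Oct) : (x - y).fst = x.fst - y.fst := rfl
@[simp] theorem sub_snd (x y : Oct) : (x - y).snd = x.snd - y.snd := rfl

theorem inner_eq (x y : Oct) :
    inner ℝ x y = x.fst.re * y.fst.re + x.fst.imI * y.fst.imI + x.fst.imJ * y.fst.imJ
      + x.fst.imK * y.fst.imK + (x.snd.re * y.snd.re + x.snd.imI * y.snd.imI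
      + x.snd.imJ * y.snd.imJ + x.snd.imK * y.snd.imK) := by
  have h : inner ℝ x y = inner ℝ x.fst y.fst + inner ℝ x.snd y.snd :=
    WithLp.prod_inner_apply (𝕜 := ℝ) (E := ℍ[ℝ]) (F := ℍ[ℝ]) x y
  rw [h, Quaternion.inner_def, Quaternion.inner_def]
  simp only [Quaternion.re_mul, Quaternion.re_star, Quaternion.imI_star, Quaternion.imJ_star,
    Quaternion.imK_star]
  ring

scoped instance : NonAssocRing Oct where
  left_distrib x y z := (L x).map_add y z
  right_distrib x y z := (R z).map_add x y
  zero_mul x := (R x).map_zero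
  mul_zero x := (L x).map_zero
  one_mul x := by ext1 <;> simp
  mul_one x := by ext1 <;> simp

scoped instance : IsScalarTower ℝ Oct Oct := ⟨fun r x y => (R y).map_smul r x⟩

scoped instance : SMulCommClass ℝ Oct Oct := ⟨fun r x y => ((L x).map_smul r y).symm⟩

end Oct

open Oct

@[simp] theorem L_apply (x y : Oct) : L x y = x * y := rfl

theorem C_apply (x : Oct) : C x = (2 * inner ℝ x 1 : ℝ) • (1 : Oct) - x := rfl

theorem C_eq_mk (x : Oct) : C x = Oct.mk (star x.fst) (-x.snd) := by
  rw [C_apply, Oct.inner_eq]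
  ext <;> simp; ring

@[simp] theorem C_fst (x : Oct) : (C x).fst = star x.fst := by rw [C_eq_mk]; rfl
@[simp] theorem C_snd (x : Oct) : (C x).snd = -x.snd := by rw [C_eq_mk]; rfl

@[simp] theorem C_C (x : Oct) : C (C x) = x := by ext1 <;> simp

@[simp] theorem C_one : C 1 = 1 := by ext1 <;> simp

theorem C_mul (x y : Oct) : C (x * y) = C y * C x := by ext1 <;> simp

theorem inner_C_C (x y : Oct) : inner ℝ (C x) (C y) = inner ℝ x y := by
  simp [Oct.inner_eq]

@[simp] theorem norm_C (x : Oct) : ‖C x‖ = ‖x‖ := norm_eq_of_inner_self_eq (inner_C_C x x)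

theorem inner_C_left (x y : Oct) : inner ℝ (C x) y = inner ℝ x (C y) := by
  rw [← inner_C_C, C_C]

theorem inner_mul_left_C (x y z : Oct) : inner ℝ (x * y) z = inner ℝ y (C x * z) := by
  simp [Oct.inner_eq]
  ring

theorem inner_mul_right_C (x y z : Oct) : inner ℝ (x * y) z = inner ℝ x (z * C y) := by
  simp [Oct.inner_eq]
  ring

theorem C_mul_mul (x y : Oct) : C x * (x * y) = ‖x‖ ^ 2 • y := by
  rw [← real_inner_self_eq_norm_sq, Oct.inner_eq]
  ext <;> simp <;> ring

theorem mul_C_mul (x y : Oct) : x * (C x * y) = ‖x‖ ^ 2 • y := by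
  simpa using C_mul_mul (C x) y

theorem mul_mul_C (x y : Oct) : (y * x) * C x = ‖x‖ ^ 2 • y := by
  have h := congrArg C (mul_C_mul x (C y))
  rwa [C_mul, C_mul, C_C, C_C, map_smul, C_C] at h

theorem inner_mul_mul (x y z : Oct) : inner ℝ (x * y) (x * z) = ‖x‖ ^ 2 * inner ℝ y z := by
  rw [inner_mul_left_C, C_mul_mul, real_inner_smul_right]

instance : NormMulClass Oct where
  norm_mul x y := by
    rw [norm_eq_sqrt_real_inner, inner_mul_mul, real_inner_self_eq_norm_sq, ← mul_pow,
      Real.sqrt_sq (by positivity)]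

instance : NormOneClass Oct where
  norm_one := by rw [norm_eq_sqrt_real_inner, Oct.inner_eq]; simp

instance : Nontrivial Oct := ⟨1, 0, fun h => by simpa using congrArg norm h⟩

instance : NoZeroDivisors Oct where
  eq_zero_or_eq_zero_of_mul_eq_zero {x y} h := by
    rwa [← norm_eq_zero, norm_mul, mul_eq_zero, norm_eq_zero, norm_eq_zero] at h

theorem mul_C_mul_add (x y z : Oct) :
    x * (C y * z) + y * (C x * z) = (2 * inner ℝ x y : ℝ) • z := by
  have h := mul_C_mul (x + y) z
  simp only [map_add, add_mul, mul_add, mul_C_mul, norm_add_sq_real, add_smul] at h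
  linear_combination (norm := module) h

instance : FiniteDimensional ℝ Oct :=
  inferInstanceAs (FiniteDimensional ℝ (WithLp 2 (ℍ[ℝ] × ℍ[ℝ])))

theorem finrank_oct : finrank ℝ Oct = 8 :=
  (WithLp.linearEquiv 2 ℝ (ℍ[ℝ] × ℍ[ℝ])).finrank_eq.trans
    (by rw [finrank_prod, Quaternion.finrank_eq_four])

/-- The imaginary octonions. -/
abbrev Im : Submodule ℝ Oct := (ℝ ∙ (1 : Oct))ᗮ

/-- The unit sphere `S⁶` of imaginary octonions. -/
abbrev ImUnit : Type := sphere (0 : Im) 1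

theorem mem_Im {x : Oct} : x ∈ Im ↔ inner ℝ x 1 = 0 := by
  rw [Submodule.mem_orthogonal_singleton_iff_inner_left]

theorem mem_Im_iff_C {x : Oct} : x ∈ Im ↔ C x = -x := by
  rw [mem_Im, C_apply, sub_eq_neg_self, smul_eq_zero_iff_left one_ne_zero]
  simp

theorem finrank_Im : finrank ℝ Im = 7 := by
  have h : _ + finrank ℝ Im = _ := Submodule.finrank_add_finrank_orthogonal (ℝ ∙ (1 : Oct))
  rw [finrank_span_singleton one_ne_zero, finrank_oct] at h
  omega

theorem ImUnit.C_coe (e : ImUnit) : C (e : Oct) = -e := mem_Im_iff_C.1 e.1.2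

theorem ImUnit.norm_coe (e : ImUnit) : ‖(e : Oct)‖ = 1 := norm_eq_of_mem_sphere e

theorem ImUnit.mul_mul_self (e : ImUnit) (x : Oct) : (e : Oct) * (e * x) = -x := by
  have h := C_mul_mul (e : Oct) x
  rwa [e.C_coe, e.norm_coe, one_pow, one_smul, neg_mul, neg_eq_iff_eq_neg] at h

theorem mul_mul_eq_neg_of_mem_Im {x y : Oct} (hx : x ∈ Im) (hy : y ∈ Im) (hxy : inner ℝ x y = 0)
    (z : Oct) : x * (y * z) = -(y * (x * z)) := by
  have h := mul_C_mul_add x y z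
  rw [mem_Im_iff_C.1 hx, mem_Im_iff_C.1 hy, hxy, mul_zero, zero_smul, neg_mul, neg_mul, mul_neg,
    mul_neg, ← neg_add, neg_eq_zero] at h
  exact eq_neg_of_add_eq_zero_left h

theorem mul_mem_Im {x y : Oct} (hy : y ∈ Im) (hxy : inner ℝ x y = 0) : x * y ∈ Im := by
  rw [mem_Im, inner_mul_right_C, mem_Im_iff_C.1 hy, one_mul, inner_neg_right, hxy, neg_zero]

theorem mul_mul_eq_neg_mul_mul {x y z : Oct} (hx : x ∈ Im) (hy : y ∈ Im) (hz : z ∈ Im)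
    (hxy : inner ℝ x y = 0) (hxz : inner ℝ x z = 0) (hyz : inner ℝ y z = 0)
    (hxyz : inner ℝ (x * y) z = 0) : (x * y) * z = -(x * (y * z)) := by
  have hanti : ∀ {a b : Oct}, a ∈ Im → b ∈ Im → inner ℝ a b = 0 → a * b = -(b * a) :=
    fun {a b} ha hb hab => by simpa using mul_mul_eq_neg_of_mem_Im ha hb hab 1
  rw [hanti (mul_mem_Im hy hxy) hz hxyz,
    mul_mul_eq_neg_of_mem_Im hz hx ((real_inner_comm _ _).trans hxz), hanti hy hz hyz, mul_neg,
    neg_neg]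

/-- An imaginary element `c` of the middle nucleus vanishes: for unit imaginary `e ⟂ c` and
`f ⟂ e, c, e c` the associator `(e c) f - e (c f)` is `-2 e (c f)`. -/
theorem eq_smul_one_of_middle_nucleus {c : Oct} (h : ∀ x y : Oct, (x * c) * y = x * (c * y)) :
    c = (inner ℝ c 1 : ℝ) • (1 : Oct) := by
  set c' := c - (inner ℝ c 1 : ℝ) • (1 : Oct) with hc'
  have hmem : c' ∈ Im := by
    rw [mem_Im, inner_sub_left, real_inner_smul_left, real_inner_self_eq_norm_sq, norm_one]
    ring
  have hassoc : ∀ x y : Oct, (x * c') * y = x * (c' * y) := fun x y => by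
    simp only [hc', mul_sub, sub_mul, h, mul_smul_comm, smul_mul_assoc, mul_one, one_mul]
  obtain ⟨e, he⟩ := exists_unit_orthogonal ![1, c'] (by simp [finrank_oct])
  obtain ⟨f, hf⟩ := exists_unit_orthogonal ![1, c', e, e * c'] (by simp [finrank_oct])
  simp only [Fin.forall_fin_succ, Matrix.cons_val_zero, Matrix.cons_val_succ, IsEmpty.forall_iff,
    and_true] at he hf
  have hneg := mul_mul_eq_neg_mul_mul (mem_Im.2 ((real_inner_comm _ _).trans he.1)) hmem
    (mem_Im.2 ((real_inner_comm _ _).trans hf.1)) ((real_inner_comm _ _).trans he.2) hf.2.2.1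
    hf.2.1 hf.2.2.2
  have : IsAddTorsionFree Oct := .of_isTorsionFree ℝ Oct
  rw [hassoc, self_eq_neg] at hneg
  have hnorm := congrArg norm hneg
  rw [norm_mul, norm_mul, norm_eq_of_mem_sphere, norm_eq_of_mem_sphere, one_mul, mul_one,
    norm_zero, norm_eq_zero] at hnorm
  exact sub_eq_zero.1 hnorm

theorem eq_smul_one_of_right_nucleus {c : Oct} (h : ∀ x y : Oct, (x * y) * c = x * (y * c)) :
    c = (inner ℝ c 1 : ℝ) • (1 : Oct) := by
  have hmiddle (x y : Oct) : (x * C c) * y = x * (C c * y) := by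
    refine ext_inner_left ℝ fun z => ?_
    rw [← C_C y, ← inner_mul_right_C, ← inner_mul_right_C, h, inner_mul_right_C, C_mul]
  have hC := congrArg C (eq_smul_one_of_middle_nucleus hmiddle)
  rwa [C_C, map_smul, C_one, inner_C_left, C_one] at hC

/-! ### The Clifford operators -/

namespace Oct2

@[simp] theorem zero_fst : (0 : Oct2).fst = 0 := rfl
@[simp] theorem zero_snd : (0 : Oct2).snd = 0 := rfl
@[simp] theorem neg_fst (v : Oct2) : (-v).fst = -v.fst := rfl
@[simp] theorem neg_snd (v : Oct2) : (-v).snd = -v.snd := rfl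

theorem inner_eq (v w : Oct2) : inner ℝ v w = inner ℝ v.fst w.fst + inner ℝ v.snd w.snd :=
  WithLp.prod_inner_apply (𝕜 := ℝ) (E := Oct) (F := Oct) v w

theorem norm_sq_eq (v : Oct2) : ‖v‖ ^ 2 = ‖v.fst‖ ^ 2 + ‖v.snd‖ ^ 2 :=
  WithLp.prod_norm_sq_eq_of_L2 v

end Oct2

instance : FiniteDimensional ℝ Oct2 :=
  inferInstanceAs (FiniteDimensional ℝ (WithLp 2 (Oct × Oct)))

/-- The space `ℝ ⊕ O` on which `Spin(9)` acts through `SO(9)`. -/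
abbrev Vec9 : Type := WithLp 2 (ℝ × Oct)

theorem finrank_Vec9 : finrank ℝ Vec9 = 9 :=
  (WithLp.linearEquiv 2 ℝ (ℝ × Oct)).finrank_eq.trans
    (by rw [finrank_prod, finrank_self, finrank_oct])

theorem Vec9.inner_eq (v w : Vec9) : inner ℝ v w = v.fst * w.fst + inner ℝ v.snd w.snd := by
  rw [WithLp.prod_inner_apply]
  simp [mul_comm]

theorem Vec9.norm_sq_eq (v : Vec9) : ‖v‖ ^ 2 = v.fst ^ 2 + ‖v.snd‖ ^ 2 := by
  rw [WithLp.prod_norm_sq_eq_of_L2, Real.norm_eq_abs, sq_abs]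

@[simp] theorem blockMap_fst (r : ℝ) (x : Oct) (v : Oct2) :
    (blockMap r x v).fst = r • v.fst + C x * C v.snd :=
  congrArg (r • v.fst + ·) (C_mul _ _)

@[simp] theorem blockMap_snd (r : ℝ) (x : Oct) (v : Oct2) :
    (blockMap r x v).snd = C v.fst * C x - r • v.snd :=
  congrArg (· - r • v.snd) (C_mul _ _)

/-- Clifford multiplication of `ℝ ⊕ O` on `O²`, without the factor `i`. The octonion is conjugated,
so that `⟨clifford w v, v⟩ = ⟨w, σ v⟩`. -/
def clifford : Vec9 →ₗ[ℝ] End ℝ Oct2 where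
  toFun w := blockMap w.fst (C w.snd)
  map_add' u w := by
    ext1 v
    ext1 <;> simp only [blockMap_fst, blockMap_snd, WithLp.add_fst, WithLp.add_snd, C_C, map_add,
      LinearMap.add_apply, Oct2.add_fst, Oct2.add_snd, add_mul, mul_add] <;> module
  map_smul' r w := by
    ext1 v
    ext1 <;> simp [smul_smul, smul_sub, smul_mul_assoc, mul_smul_comm]

theorem clifford_fst (w : Vec9) (v : Oct2) :
    (clifford w v).fst = w.fst • v.fst + w.snd * C v.snd := by
  simp [clifford]

theorem clifford_snd (w : Vec9) (v : Oct2) :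
    (clifford w v).snd = C v.fst * w.snd - w.fst • v.snd := by
  simp [clifford]

theorem clifford_clifford (w : Vec9) (v : Oct2) : clifford w (clifford w v) = ‖w‖ ^ 2 • v := by
  ext1
  · simp only [clifford_fst, clifford_snd, map_sub, C_mul, C_C, map_smul, mul_sub, mul_C_mul,
      Oct2.smul_fst, Vec9.norm_sq_eq, mul_smul_comm]
    module
  · have h : v.snd * C w.snd * w.snd = ‖w.snd‖ ^ 2 • v.snd := by
      simpa using mul_mul_C (C w.snd) v.snd
    simp only [clifford_fst, clifford_snd, map_add, C_mul, C_C, map_smul, add_mul, Oct2.smul_snd,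
      Vec9.norm_sq_eq, smul_mul_assoc, h]
    module

theorem clifford_clifford_add (u w : Vec9) (v : Oct2) :
    clifford u (clifford w v) + clifford w (clifford u v) = (2 * inner ℝ u w : ℝ) • v := by
  have h := clifford_clifford (u + w) v
  simp only [map_add, LinearMap.add_apply, clifford_clifford, norm_add_sq_real] at h
  linear_combination (norm := module) h

theorem inner_clifford_left (w : Vec9) (v v' : Oct2) :
    inner ℝ (clifford w v) v' = inner ℝ v (clifford w v') := by
  have h₁ : inner ℝ (w.snd * C v.snd) v'.fst = inner ℝ v.snd (C v'.fst * w.snd) := by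
    rw [inner_mul_left_C, inner_C_left, C_mul, C_C]
  have h₂ : inner ℝ (C v.fst * w.snd) v'.snd = inner ℝ v.fst (w.snd * C v'.snd) := by
    rw [inner_mul_right_C, inner_C_left, C_mul, C_C]
  simp only [Oct2.inner_eq, clifford_fst, clifford_snd, inner_add_left, inner_add_right,
    inner_sub_left, inner_sub_right, real_inner_smul_left, real_inner_smul_right, h₁, h₂]
  ring

theorem inner_clifford_self (w : Vec9) (v : Oct2) :
    inner ℝ (clifford w v) v = inner ℝ w (σ v) := by
  have h₁ : inner ℝ (w.snd * C v.snd) v.fst = inner ℝ w.snd (v.fst * v.snd) := by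
    rw [inner_mul_right_C, C_C]
  have h₂ : inner ℝ (C v.fst * w.snd) v.snd = inner ℝ w.snd (v.fst * v.snd) := by
    rw [inner_mul_left_C, C_C]
  simp only [Oct2.inner_eq, clifford_fst, clifford_snd, Vec9.inner_eq, σ, inner_add_left,
    inner_sub_left, real_inner_smul_left, h₁, h₂,
    real_inner_self_eq_norm_sq, WithLp.toLp_fst, WithLp.toLp_snd, real_inner_smul_right]
  ring

/-! ### Generators of `Spin(9)` -/

/-- The unit vectors of `ℝ ⊕ O`. -/
abbrev Sphere8 : Type := sphere (0 : Vec9) 1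

theorem clifford_clifford_unit (u : Sphere8) (v : Oct2) :
    clifford u (clifford u v) = v := by
  rw [clifford_clifford, norm_eq_of_mem_sphere, one_pow, one_smul]

/-- The invertible operator given by Clifford multiplication by a unit vector. -/
def cliffordUnit (u : Sphere8) : GLOct2 where
  val := LinearMap.toContinuousLinearMap (clifford u)
  inv := LinearMap.toContinuousLinearMap (clifford u)
  val_inv := ContinuousLinearMap.ext (clifford_clifford_unit u)
  inv_val := ContinuousLinearMap.ext (clifford_clifford_unit u)

@[simp] theorem cliffordUnit_smul (u : Sphere8) (v : Oct2) : cliffordUnit u • v = clifford u v :=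
  rfl

theorem norm_clifford (u : Sphere8) (v : Oct2) : ‖clifford u v‖ = ‖v‖ :=
  norm_eq_of_inner_self_eq (by rw [inner_clifford_left, clifford_clifford_unit])

theorem baseChange_complex_injective {V W : Type*} [AddCommGroup V] [Module ℝ V] [AddCommGroup W]
    [Module ℝ W] :
    Function.Injective fun A : V →ₗ[ℝ] W => A.baseChange ℂ := by
  intro A B h
  ext v
  have hv := congrArg (fun z => TensorProduct.lid ℝ W (Complex.reLm.rTensor W z))
    (LinearMap.congr_fun h (1 ⊗ₜ v))
  simpa using hv

theorem m_comp_m (u w : Vec9) : m u.fst (C u.snd) ∘ₗ m w.fst (C w.snd) =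
    (-(clifford u ∘ₗ clifford w)).baseChange ℂ := by
  rw [LinearMap.baseChange_neg, LinearMap.baseChange_comp]
  simp only [m, LinearMap.smul_comp, LinearMap.comp_smul, smul_smul, Complex.I_mul_I]
  exact neg_one_smul _ _

theorem Spin9_eq_closure : Spin9 = Subgroup.closure
    (Set.range fun p : Sphere8 × Sphere8 => cliffordUnit p.1 * cliffordUnit p.2) := by
  rw [Spin9]
  congr 1
  ext g
  constructor
  · rintro ⟨r, x, s, y, hr, hs, h⟩
    have hunit : ∀ {r : ℝ} {x : Oct}, r ^ 2 + ‖x‖ ^ 2 = 1 →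
        (WithLp.toLp 2 (r, C x) : Vec9) ∈ sphere (0 : Vec9) 1 := fun {r x} h => by
      rw [mem_sphere_zero_iff_norm, ← pow_eq_one_iff_of_nonneg (norm_nonneg _) two_ne_zero,
        Vec9.norm_sq_eq]
      simpa using h
    refine ⟨(-⟨_, hunit hr⟩, ⟨_, hunit hs⟩), Units.ext (ContinuousLinearMap.coe_injective
      (baseChange_complex_injective ?_))⟩
    have hm := m_comp_m (WithLp.toLp 2 (r, C x)) (WithLp.toLp 2 (s, C y))
    simp only [WithLp.toLp_fst, WithLp.toLp_snd, C_C] at hm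
    rw [← LinearMap.neg_comp, ← map_neg] at hm
    exact (h.trans hm).symm
  · rintro ⟨⟨u, w⟩, rfl⟩
    have hunit : ∀ u : Sphere8, (u : Vec9).fst ^ 2 + ‖C (u : Vec9).snd‖ ^ 2 = 1 := fun u => by
      rw [norm_C, ← Vec9.norm_sq_eq, norm_eq_of_mem_sphere, one_pow]
    refine ⟨_, _, _, _, hunit (-u), hunit w, ?_⟩
    rw [m_comp_m, ← LinearMap.neg_comp, coe_neg_sphere, map_neg, neg_neg]
    rfl

theorem cliffordUnit_mul_mem (u w : Sphere8) : cliffordUnit u * cliffordUnit w ∈ Spin9 :=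
  Spin9_eq_closure ▸ Subgroup.subset_closure ⟨(u, w), rfl⟩

theorem det_clifford_mul_det_of_orthogonal {u w : Sphere8} (h : inner ℝ (u : Vec9) w = 0) :
    LinearMap.det (clifford u) * LinearMap.det (clifford w) = 1 := by
  rw [← map_mul]
  refine det_eq_one_of_mul_self_eq_neg_one (LinearMap.ext fun v => ?_)
  have hanti := clifford_clifford_add (u : Vec9) w (clifford u (clifford w v))
  rw [h, mul_zero, zero_smul, clifford_clifford_unit, clifford_clifford_unit] at hanti
  exact eq_neg_of_add_eq_zero_left hanti

theorem det_clifford_mul_det (u w : Sphere8) :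
    LinearMap.det (clifford u) * LinearMap.det (clifford w) = 1 := by
  obtain ⟨z, hz⟩ := exists_unit_orthogonal ![(u : Vec9), w] (by simp [finrank_Vec9])
  have huz := det_clifford_mul_det_of_orthogonal (hz 0)
  have hwz := det_clifford_mul_det_of_orthogonal (hz 1)
  have hzz : LinearMap.det (clifford z) * LinearMap.det (clifford z) = 1 := by
    rw [← map_mul, show clifford (z : Vec9) * clifford z = 1 from
      LinearMap.ext (clifford_clifford_unit z), map_one]
  linear_combination (LinearMap.det (clifford w) * LinearMap.det (clifford z)) * huz + hwz
    - (LinearMap.det (clifford u) * LinearMap.det (clifford w)) * hzz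

theorem Spin9_le_SO16 : Spin9 ≤ SO16 := by
  rw [Spin9_eq_closure, Subgroup.closure_le]
  rintro _ ⟨⟨u, w⟩, rfl⟩
  exact ⟨fun v => (norm_clifford u _).trans (norm_clifford w v),
    (LinearMap.det_comp (clifford u) (clifford w)).trans (det_clifford_mul_det u w)⟩

/-! ### The squaring map and the covering of `SO(9)` -/

@[simp] theorem σ_fst (v : Oct2) : (σ v).fst = ‖v.fst‖ ^ 2 - ‖v.snd‖ ^ 2 := rfl
@[simp] theorem σ_snd (v : Oct2) : (σ v).snd = (2 : ℝ) • (v.fst * v.snd) := rfl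

theorem norm_σ (v : Oct2) : ‖σ v‖ = ‖v‖ ^ 2 := by
  refine (pow_left_inj₀ (norm_nonneg _) (by positivity) two_ne_zero).1 ?_
  rw [Vec9.norm_sq_eq, Oct2.norm_sq_eq, σ_fst, σ_snd, norm_smul, norm_mul, Real.norm_eq_abs,
    abs_two]
  ring

theorem σ_clifford (u : Sphere8) (v : Oct2) : σ (clifford u v) = -unitReflection u (σ v) := by
  refine ext_inner_left ℝ fun w => ?_
  have hswap := clifford_clifford_add (u : Vec9) w (clifford u v)
  rw [clifford_clifford_unit] at hswap
  calc inner ℝ w (σ (clifford u v))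
      = inner ℝ (clifford u (clifford w (clifford u v))) v := by
        rw [← inner_clifford_self, inner_clifford_left u]
    _ = 2 * inner ℝ (u : Vec9) w * inner ℝ (clifford u v) v - inner ℝ (clifford w v) v := by
        rw [eq_sub_of_add_eq hswap, inner_sub_left, real_inner_smul_left]
    _ = inner ℝ w (-unitReflection u (σ v)) := by
        rw [inner_clifford_self, inner_clifford_self, unitReflection_apply, neg_sub,
          inner_sub_right, real_inner_smul_right, real_inner_comm w]
        ring

/-- The operator `g` on `O²` covers the isometry `ρ` of `ℝ ⊕ O` through the squaring map. -/
def Covers (g : GLOct2) (ρ : Vec9 ≃ₗᵢ[ℝ] Vec9) : Prop := ∀ v : Oct2, σ (g • v) = ρ (σ v)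

namespace Covers

variable {g h : GLOct2} {ρ τ : Vec9 ≃ₗᵢ[ℝ] Vec9}

theorem one : Covers 1 1 := fun v => congrArg σ (one_smul GLOct2 v)

theorem mul (hg : Covers g ρ) (hh : Covers h τ) : Covers (g * h) (ρ * τ) := fun v => by
  rw [mul_smul, hg, hh]
  rfl

theorem inv (hg : Covers g ρ) : Covers g⁻¹ ρ⁻¹ := fun v =>
  ρ.injective <| by
    rw [← hg, smul_inv_smul]
    exact (ρ.apply_symm_apply _).symm

theorem norm_smul (hg : Covers g ρ) (v : Oct2) : ‖g • v‖ = ‖v‖ := by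
  refine (pow_left_inj₀ (norm_nonneg _) (norm_nonneg _) two_ne_zero).1 ?_
  rw [← norm_σ, hg, ρ.norm_map, norm_σ]

theorem cliffordUnit_mul (u w : Sphere8) :
    Covers (cliffordUnit u * cliffordUnit w) (unitReflection u * unitReflection w) := fun v => by
  rw [mul_smul, cliffordUnit_smul, cliffordUnit_smul, σ_clifford, σ_clifford, map_neg, neg_neg]
  rfl

end Covers

theorem exists_covers_of_mem_Spin9 {g : GLOct2} (hg : g ∈ Spin9) :
    ∃ ρ : Vec9 ≃ₗᵢ[ℝ] Vec9, isometryDet ρ = 1 ∧ Covers g ρ := by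
  rw [Spin9_eq_closure] at hg
  induction hg using Subgroup.closure_induction with
  | mem g hg =>
    obtain ⟨⟨u, w⟩, rfl⟩ := hg
    exact ⟨_, by rw [map_mul, isometryDet_unitReflection, isometryDet_unitReflection]; norm_num,
      Covers.cliffordUnit_mul u w⟩
  | one => exact ⟨1, map_one _, Covers.one⟩
  | mul g h _ _ hg hh =>
    obtain ⟨ρ, hρ, hg⟩ := hg
    obtain ⟨τ, hτ, hh⟩ := hh
    exact ⟨ρ * τ, by rw [map_mul, hρ, hτ, one_mul], hg.mul hh⟩
  | inv g _ hg =>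
    obtain ⟨ρ, hρ, hg⟩ := hg
    exact ⟨ρ⁻¹, MonoidHom.mem_ker.1 (inv_mem (MonoidHom.mem_ker.2 hρ)), hg.inv⟩

theorem exists_covers_prod_unitReflection (l : List Sphere8) (hl : Even l.length) :
    ∃ g ∈ Spin9, Covers g (l.map unitReflection).prod := by
  match l with
  | [] => exact ⟨1, one_mem _, Covers.one⟩
  | [u] => simp at hl
  | u :: w :: l =>
    obtain ⟨g, hg, hcov⟩ := exists_covers_prod_unitReflection l
      (by simpa [Nat.even_add_one, parity_simps] using hl)
    refine ⟨_, mul_mem (cliffordUnit_mul_mem u w) hg, ?_⟩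
    rw [List.map_cons, List.map_cons, List.prod_cons, List.prod_cons, ← mul_assoc]
    exact (Covers.cliffordUnit_mul u w).mul hcov

theorem exists_mem_Spin9_covers {ρ : Vec9 ≃ₗᵢ[ℝ] Vec9} (hρ : isometryDet ρ = 1) :
    ∃ g ∈ Spin9, Covers g ρ := by
  obtain ⟨l, -, rfl⟩ := exists_prod_unitReflection ρ
  rw [isometryDet_prod_unitReflection, neg_one_pow_eq_one_iff_even (by norm_num)] at hρ
  exact exists_covers_prod_unitReflection l hρ

/-- The operator `(x, y) ↦ (g₁ x, g₃ y)`. -/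
def blockDiag (g₁ g₃ : Oct ≃ₗᵢ[ℝ] Oct) : GLOct2 :=
  ContinuousLinearEquiv.toUnit
    (g₁.withLpProdCongr 2 g₃ : Oct2 ≃ₗᵢ[ℝ] Oct2).toContinuousLinearEquiv

@[simp] theorem blockDiag_smul (g₁ g₃ : Oct ≃ₗᵢ[ℝ] Oct) (v : Oct2) :
    blockDiag g₁ g₃ • v = Oct2.mk (g₁ v.fst) (g₃ v.snd) := rfl

theorem GLOct2_ext {g h : GLOct2} (hgh : ∀ v : Oct2, g • v = h • v) : g = h :=
  Units.ext (ContinuousLinearMap.ext hgh)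

theorem exists_eq_blockDiag {g : GLOct2} (hfst : ∀ v : Oct2, ‖(g • v).fst‖ = ‖v.fst‖)
    (hsnd : ∀ v : Oct2, ‖(g • v).snd‖ = ‖v.snd‖) : ∃ g₁ g₃, g = blockDiag g₁ g₃ := by
  let G : Oct2 →ₗ[ℝ] Oct2 := (g : Oct2 →L[ℝ] Oct2)
  let e : Oct2 ≃ₗ[ℝ] Oct × Oct := WithLp.linearEquiv 2 ℝ (Oct × Oct)
  let inl : Oct →ₗ[ℝ] Oct2 := e.symm ∘ₗ LinearMap.inl ℝ Oct Oct
  let inr : Oct →ₗ[ℝ] Oct2 := e.symm ∘ₗ LinearMap.inr ℝ Oct Oct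
  let fst : Oct2 →ₗ[ℝ] Oct := LinearMap.fst ℝ Oct Oct ∘ₗ e
  let snd : Oct2 →ₗ[ℝ] Oct := LinearMap.snd ℝ Oct Oct ∘ₗ e
  refine ⟨isometryOfNormMap (fst ∘ₗ G ∘ₗ inl) fun x => hfst (inl x),
    isometryOfNormMap (snd ∘ₗ G ∘ₗ inr) fun y => hsnd (inr y), GLOct2_ext fun v => ?_⟩
  have hv : v = inl v.fst + inr v.snd := Oct2.ext (add_zero _).symm (zero_add _).symm
  have hinl : (G (inl v.fst)).snd = 0 :=
    norm_eq_zero.1 ((hsnd (inl v.fst)).trans norm_zero)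
  have hinr : (G (inr v.snd)).fst = 0 :=
    norm_eq_zero.1 ((hfst (inr v.snd)).trans norm_zero)
  change G v = _
  conv_lhs => rw [hv, map_add]
  refine Oct2.ext ?_ ?_
  · rw [Oct2.add_fst, hinr, add_zero]
    rfl
  · rw [Oct2.add_snd, hinl, zero_add]
    rfl

/-- The north pole `(1, 0) = σ (1, 0)` of the unit sphere of `ℝ ⊕ O`. -/
def northPole : Vec9 := WithLp.toLp 2 (1, 0)

theorem inner_northPole (w : Vec9) : inner ℝ northPole w = w.fst := by
  simp [northPole]

theorem Covers.exists_eq_blockDiag {g : GLOct2} {ρ : Vec9 ≃ₗᵢ[ℝ] Vec9} (hg : Covers g ρ)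
    (hρ : ρ northPole = northPole) : ∃ g₁ g₃, g = blockDiag g₁ g₃ := by
  have hdiff (v : Oct2) : ‖(g • v).fst‖ ^ 2 - ‖(g • v).snd‖ ^ 2 = ‖v.fst‖ ^ 2 - ‖v.snd‖ ^ 2 := by
    rw [← σ_fst, ← σ_fst, hg, ← inner_northPole, ← inner_northPole]
    conv_lhs => rw [← hρ, ρ.inner_map_map]
  have hsum (v : Oct2) : ‖(g • v).fst‖ ^ 2 + ‖(g • v).snd‖ ^ 2 = ‖v.fst‖ ^ 2 + ‖v.snd‖ ^ 2 := by
    rw [← Oct2.norm_sq_eq, ← Oct2.norm_sq_eq, hg.norm_smul]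
  refine SpinNine.exists_eq_blockDiag (fun v => ?_) fun v => ?_ <;>
    exact (pow_left_inj₀ (norm_nonneg _) (norm_nonneg _) two_ne_zero).1
      (by linarith [hdiff v, hsum v])

theorem neg_one_mem_Spin9 : (-1 : GLOct2) ∈ Spin9 := by
  let u : Sphere8 := ⟨northPole, by simp [northPole]⟩
  convert cliffordUnit_mul_mem (-u) u
  refine GLOct2_ext fun v => ?_
  rw [mul_smul, cliffordUnit_smul, cliffordUnit_smul, coe_neg_sphere, map_neg,
    LinearMap.neg_apply, clifford_clifford_unit]
  rfl

theorem eq_one_or_eq_neg_one_of_covers_one {g : GLOct2} (hg : Covers g 1) : g = 1 ∨ g = -1 := by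
  obtain ⟨g₁, g₃, rfl⟩ := hg.exists_eq_blockDiag rfl
  have hmul (a b : Oct) : g₁ a * g₃ b = a * b :=
    smul_right_injective Oct (two_ne_zero' ℝ) (congrArg WithLp.snd (hg (Oct2.mk a b)))
  set c := g₃ 1
  have hc : ‖c‖ = 1 := (g₃.norm_map 1).trans norm_one
  have h₁ (a : Oct) : g₁ a = a * C c := by
    have h := mul_mul_C c (g₁ a)
    rwa [hmul, mul_one, hc, one_pow, one_smul, eq_comm] at h
  have h₃ (b : Oct) : g₃ b = c * b := by
    have h := mul_C_mul c (g₃ b)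
    rwa [← one_mul (C c), ← h₁, hmul, hc, one_mul, one_pow, one_smul, eq_comm] at h
  have hnuc := eq_smul_one_of_middle_nucleus (c := c) fun x y => by
    rw [← h₃, ← hmul (x * c), h₁, mul_mul_C, hc, one_pow, one_smul]
  have habs : |(inner ℝ c 1 : ℝ)| = 1 := by
    rwa [hnuc, norm_smul, norm_one, mul_one, Real.norm_eq_abs] at hc
  refine (eq_or_eq_neg_of_abs_eq habs).imp (fun h => ?_) fun h => ?_ <;>
    refine GLOct2_ext fun v => ?_ <;> rw [blockDiag_smul, h₁, h₃, hnuc, h]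
  · simp only [one_smul, C_one, mul_one, one_mul]
    rfl
  · simp only [neg_smul, one_smul, map_neg, C_one, mul_neg, neg_mul, mul_one, one_mul]
    rfl

theorem mem_Spin9_iff {g : GLOct2} : g ∈ Spin9 ↔ ∃ ρ, isometryDet ρ = 1 ∧ Covers g ρ := by
  refine ⟨exists_covers_of_mem_Spin9, fun ⟨ρ, hρ, hg⟩ => ?_⟩
  obtain ⟨h, hh, hcov⟩ := exists_mem_Spin9_covers hρ
  rw [← mul_inv_cancel_left h g]
  refine mul_mem hh ?_
  have hone : Covers (h⁻¹ * g) 1 := inv_mul_cancel ρ ▸ hcov.inv.mul hg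
  rcases eq_one_or_eq_neg_one_of_covers_one hone with h | h <;> rw [h]
  exacts [one_mem _, neg_one_mem_Spin9]

/-! ### Transitivity on spheres -/

theorem exists_clifford_snd_eq_zero (v : Oct2) : ∃ u : Sphere8, (clifford u v).snd = 0 := by
  suffices h : ∃ w : Vec9, w ≠ 0 ∧ (clifford w v).snd = 0 by
    obtain ⟨w, hw, h⟩ := h
    refine ⟨⟨‖w‖⁻¹ • w, by simp [norm_smul, hw]⟩, ?_⟩
    rw [map_smul, LinearMap.smul_apply, Oct2.smul_snd, h, smul_zero]
  by_cases hv : v.fst = 0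
  · refine ⟨WithLp.toLp 2 (0, 1), fun h => one_ne_zero (congrArg WithLp.snd h), ?_⟩
    simp [clifford_snd, hv]
  · refine ⟨WithLp.toLp 2 (‖v.fst‖ ^ 2, v.fst * v.snd), fun h => hv ?_, ?_⟩
    · simpa using congrArg WithLp.fst h
    · rw [clifford_snd, WithLp.toLp_snd, WithLp.toLp_fst, C_mul_mul, sub_self]

theorem exists_unit_C_mul_eq (a : Oct) : ∃ u : Oct, ‖u‖ = 1 ∧ C a * u = (‖a‖ : ℝ) • 1 := by
  by_cases ha : a = 0
  · exact ⟨1, norm_one, by simp [ha]⟩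
  · refine ⟨(‖a‖⁻¹ : ℝ) • a, by simp [norm_smul, ha], ?_⟩
    have h : C a * a = ‖a‖ ^ 2 • 1 := by simpa using C_mul_mul a 1
    rw [mul_smul_comm, h, smul_smul, pow_two, inv_mul_cancel_left₀ (norm_ne_zero_iff.2 ha)]

theorem exists_smul_eq_mk_norm (v : Oct2) :
    ∃ g ∈ Spin9, g • v = Oct2.mk ((‖v‖ : ℝ) • 1) 0 := by
  obtain ⟨w, hw⟩ := exists_clifford_snd_eq_zero v
  obtain ⟨a, ha⟩ : ∃ a, clifford w v = Oct2.mk a 0 := ⟨_, Oct2.ext rfl hw⟩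
  have hav : ‖a‖ = ‖v‖ := by
    have h := norm_clifford w v
    rw [← h, ha, ← pow_left_inj₀ (norm_nonneg _) (norm_nonneg _) two_ne_zero, Oct2.norm_sq_eq]
    simp
  obtain ⟨u, hu, hau⟩ := exists_unit_C_mul_eq a
  let off (x : Oct) (hx : ‖x‖ = 1) : Sphere8 := ⟨WithLp.toLp 2 (0, x), by simpa using hx⟩
  let pole : Sphere8 := ⟨northPole, by simp [northPole]⟩
  refine ⟨_, mul_mem (cliffordUnit_mul_mem pole (off 1 norm_one))
    (cliffordUnit_mul_mem (off u hu) w), ?_⟩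
  simp only [mul_smul, cliffordUnit_smul, ha]
  ext1 <;> simp [clifford_fst, clifford_snd, off, pole, northPole, hau, hav]

theorem exists_smul_eq_of_norm_eq {v w : Oct2} (h : ‖v‖ = ‖w‖) : ∃ g : Spin9, g • v = w := by
  obtain ⟨a, ha, hav⟩ := exists_smul_eq_mk_norm v
  obtain ⟨b, hb, hbw⟩ := exists_smul_eq_mk_norm w
  refine ⟨⟨b⁻¹ * a, mul_mem (inv_mem hb) ha⟩, ?_⟩
  rw [Subgroup.mk_smul, mul_smul, hav, h, ← hbw, inv_smul_smul]

theorem norm_smul_Spin9 (g : Spin9) (v : Oct2) : ‖g • v‖ = ‖v‖ := (Spin9_le_SO16 g.2).1 v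

theorem orbit_eq_sphere {v : Oct2} (hv : v ∈ sphere (0 : Oct2) 1) :
    MulAction.orbit Spin9 v = sphere (0 : Oct2) 1 := by
  rw [mem_sphere_zero_iff_norm] at hv
  ext w
  rw [mem_sphere_zero_iff_norm]
  exact ⟨fun ⟨g, hg⟩ => hg ▸ (norm_smul_Spin9 g v).trans hv,
    fun hw => exists_smul_eq_of_norm_eq (hv.trans hw.symm)⟩

/-! ### Companions of rotations fixing `1` -/

theorem exists_imUnit_orthogonal {ι : Type*} [Fintype ι] (v : ι → Oct) (h : Fintype.card ι < 7) :
    ∃ e : ImUnit, ∀ i, inner ℝ (v i) (e : Oct) = 0 := by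
  obtain ⟨e, he⟩ := exists_unit_orthogonal (fun i => Im.orthogonalProjectionOnto (v i))
    (by rwa [finrank_Im])
  exact ⟨e, fun i => (Im.inner_orthogonalProjectionOnto_eq_of_mem_right e.1 (v i)).symm.trans
    (he i)⟩

instance : Nonempty ImUnit := (exists_imUnit_orthogonal ![] (by norm_num)).nonempty

namespace ImUnit

/-- An imaginary unit, as a unit octonion. -/
def toSphere (e : ImUnit) : sphere (0 : Oct) 1 := sphereInclusion Im e

/-- Left multiplication by an imaginary unit. -/
def leftMul (e : ImUnit) : Oct ≃ₗᵢ[ℝ] Oct :=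
  isometryOfNormMap (L e) fun x => by rw [L_apply, norm_mul, e.norm_coe, one_mul]

@[simp] theorem leftMul_apply (e : ImUnit) (x : Oct) : e.leftMul x = e * x := rfl

theorem isometryDet_leftMul (e : ImUnit) : isometryDet e.leftMul = 1 :=
  det_eq_one_of_mul_self_eq_neg_one (LinearMap.ext e.mul_mul_self)

end ImUnit

/-- Octonion conjugation, as an isometry. -/
def conjIsometry : Oct ≃ₗᵢ[ℝ] Oct := (ℝ ∙ (1 : Oct)).reflection

@[simp] theorem conjIsometry_apply (x : Oct) : conjIsometry x = C x := by
  rw [conjIsometry, Submodule.reflection_singleton_apply, C_apply, real_inner_comm]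
  simp [mul_smul, two_smul]

theorem conjIsometry_sq : conjIsometry ^ 2 = 1 :=
  LinearIsometryEquiv.ext fun x => by simp [sq]

theorem isometryDet_conjIsometry : isometryDet conjIsometry = -1 := by
  refine (ℝ ∙ (1 : Oct)).det_reflection.trans ?_
  rw [finrank_Im]
  norm_num

namespace ImUnit

/-- The rotation `a ↦ e a e⁻¹`, as the composition of a reflection and octonion conjugation. -/
def conjBy (e : ImUnit) : Oct ≃ₗᵢ[ℝ] Oct := conjIsometry * unitReflection e.toSphere

theorem conjBy_apply (e : ImUnit) (x : Oct) :
    e.conjBy x = C x + (2 * inner ℝ (e : Oct) x : ℝ) • (e : Oct) := by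
  change conjIsometry (unitReflection e.toSphere x) = _
  rw [unitReflection_apply, conjIsometry_apply, map_sub, map_smul]
  change _ - _ • C (e : Oct) = _
  rw [e.C_coe, smul_neg, sub_neg_eq_add]
  rfl

theorem isometryDet_conjBy (e : ImUnit) : isometryDet e.conjBy = 1 := by
  rw [conjBy, map_mul, isometryDet_conjIsometry, isometryDet_unitReflection]
  norm_num

theorem commute_conjIsometry (e : ImUnit) : Commute conjIsometry (unitReflection e.toSphere) :=
  LinearIsometryEquiv.ext fun x => by
    change e.conjBy x = unitReflection e.toSphere (conjIsometry x)
    rw [conjBy_apply, unitReflection_apply, conjIsometry_apply]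
    change _ = C x - (2 * inner ℝ (e : Oct) (C x) : ℝ) • (e : Oct)
    rw [← inner_C_left, e.C_coe, inner_neg_left]
    module

theorem prod_conjBy {l : List ImUnit} (hl : Even l.length) :
    (l.map conjBy).prod = (l.map fun e => unitReflection e.toSphere).prod := by
  obtain ⟨n, hn⟩ := hl
  refine (prod_map_mul_left_of_commute commute_conjIsometry l).trans ?_
  rw [hn, ← two_mul, pow_mul, conjIsometry_sq, one_pow, one_mul]

theorem leftMul_mul (e : ImUnit) (a b : Oct) : e.leftMul (a * b) = e.conjBy a * e.leftMul b := by
  have h := mul_C_mul_add (e : Oct) (C a) b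
  rw [C_C, e.C_coe, ← inner_C_left, e.C_coe, inner_neg_left, neg_mul, mul_neg] at h
  rw [leftMul_apply, leftMul_apply, conjBy_apply, add_mul, smul_mul_assoc, e.mul_mul_self]
  linear_combination (norm := module) h

end ImUnit

/-- `g₃` is a companion of the rotation `g₁`: the pair underlies an element of `K₁`. -/
structure IsCompanion (g₁ g₃ : Oct ≃ₗᵢ[ℝ] Oct) : Prop where
  isometryDet_eq_one : isometryDet g₁ = 1
  map_mul : ∀ a b : Oct, g₃ (a * b) = g₁ a * g₃ b

namespace IsCompanion

variable {g₁ g₃ h₁ h₃ : Oct ≃ₗᵢ[ℝ] Oct}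

theorem mul (hg : IsCompanion g₁ g₃) (hh : IsCompanion h₁ h₃) :
    IsCompanion (g₁ * h₁) (g₃ * h₃) where
  isometryDet_eq_one := by
    rw [_root_.map_mul, hg.isometryDet_eq_one, hh.isometryDet_eq_one, one_mul]
  map_mul a b := (congrArg g₃ (hh.map_mul a b)).trans (hg.map_mul _ _)

theorem eq_left (hg : IsCompanion g₁ g₃) (hh : IsCompanion h₁ g₃) : g₁ = h₁ :=
  LinearIsometryEquiv.ext fun a =>
    mul_right_cancel₀ (g₃.toLinearEquiv.map_ne_zero_iff.2 (one_ne_zero (α := Oct)))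
      ((hg.map_mul a 1).symm.trans (hh.map_mul a 1))

theorem map_one (hg : IsCompanion g₁ g₃) : g₁ 1 = 1 :=
  mul_right_cancel₀ (g₃.toLinearEquiv.map_ne_zero_iff.2 (one_ne_zero (α := Oct)))
    ((hg.map_mul 1 1).symm.trans (by rw [one_mul, one_mul]; rfl))

theorem list_prod (l : List ImUnit) :
    IsCompanion (l.map ImUnit.conjBy).prod (l.map ImUnit.leftMul).prod := by
  induction l with
  | nil => exact ⟨_root_.map_one _, fun _ _ => rfl⟩
  | cons e l ih =>
    rw [List.map_cons, List.prod_cons, List.map_cons, List.prod_cons]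
    exact IsCompanion.mul ⟨e.isometryDet_conjBy, e.leftMul_mul⟩ ih

theorem right_eq_or_eq_neg (hg : IsCompanion g₁ g₃) (hh : IsCompanion g₁ h₃) :
    h₃ = g₃ ∨ ∀ a, h₃ a = -g₃ a := by
  have hsymm (a b : Oct) : g₃.symm (h₃ (a * b)) = a * g₃.symm (h₃ b) := by
    rw [LinearIsometryEquiv.symm_apply_eq, hg.map_mul, g₃.apply_symm_apply, hh.map_mul]
  set c := g₃.symm (h₃ 1)
  have hc (a : Oct) : g₃.symm (h₃ a) = a * c := by simpa using hsymm a 1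
  have hscalar := eq_smul_one_of_right_nucleus (c := c) fun x y => by rw [← hc, ← hc, hsymm]
  have hnorm : ‖c‖ = 1 := (g₃.symm.norm_map _).trans ((h₃.norm_map 1).trans norm_one)
  rw [hscalar, norm_smul, norm_one, mul_one, Real.norm_eq_abs] at hnorm
  refine (eq_or_eq_neg_of_abs_eq hnorm).imp (fun hr => LinearIsometryEquiv.ext fun a => ?_)
    fun hr a => ?_ <;>
  rw [← g₃.apply_symm_apply (h₃ a), hc, hscalar, hr]
  · rw [one_smul, mul_one]
  · rw [neg_one_smul, mul_neg, mul_one, map_neg]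

theorem exists_list (hg : IsCompanion g₁ g₃) : ∃ l : List ImUnit, Even l.length ∧ l.length ≤ 8 ∧
    g₁ = (l.map ImUnit.conjBy).prod ∧ g₃ = (l.map ImUnit.leftMul).prod := by
  have hfix : ∀ x ∈ ℝ ∙ (1 : Oct), g₁ x = x := fun x hx => by
    obtain ⟨r, rfl⟩ := Submodule.mem_span_singleton.1 hx
    rw [map_smul, hg.map_one]
  obtain ⟨l, hlen, hl⟩ := exists_prod_unitReflection_of_fixes hfix
  rw [finrank_Im] at hlen
  have heven : Even l.length := by
    have hdet := isometryDet_prod_unitReflection (l.map ImUnit.toSphere)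
    rw [List.map_map, List.length_map] at hdet
    exact (neg_one_pow_eq_one_iff_even (by norm_num)).1
      (hdet.symm.trans ((congrArg isometryDet hl.symm).trans hg.isometryDet_eq_one))
  have hconj : g₁ = (l.map ImUnit.conjBy).prod := hl.trans (ImUnit.prod_conjBy heven).symm
  suffices h : ∃ l : List ImUnit, Even l.length ∧ l.length ≤ 8 ∧
      g₃ = (l.map ImUnit.leftMul).prod by
    obtain ⟨l, heven, hlen, rfl⟩ := h
    exact ⟨l, heven, hlen, hg.eq_left (list_prod l), rfl⟩
  rcases (list_prod l).right_eq_or_eq_neg (hconj ▸ hg) with h | h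
  · exact ⟨l, heven, hlen.trans (by norm_num), h⟩
  · obtain ⟨e⟩ := (inferInstance : Nonempty ImUnit)
    refine ⟨e :: e :: l, by simpa [parity_simps] using heven, ?_,
      LinearIsometryEquiv.ext fun a => (h a).trans (ImUnit.mul_mul_self e _).symm⟩
    obtain ⟨n, hn⟩ := heven
    rw [List.length_cons, List.length_cons]
    omega

theorem isometryDet_right (hg : IsCompanion g₁ g₃) : isometryDet g₃ = 1 := by
  obtain ⟨l, -, -, -, rfl⟩ := hg.exists_list
  rw [map_list_prod, List.map_map]
  exact List.prod_eq_one fun r hr => by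
    obtain ⟨e, -, rfl⟩ := List.mem_map.1 hr
    exact e.isometryDet_leftMul

end IsCompanion

/-! ### The stabilizer of `(1, 0)` -/

theorem mem_K1_iff {g : GLOct2} : g ∈ K1 ↔ ∃ g₁ g₃, IsCompanion g₁ g₃ ∧ g = blockDiag g₁ g₃ := by
  constructor
  · rintro ⟨⟨g₁, g₂, g₃⟩, ⟨hdet, -, -, hmul⟩, hone, hg⟩
    obtain rfl : g₂ = g₃ := LinearIsometryEquiv.ext fun b => by
      simpa [show g₁ 1 = 1 from hone] using hmul 1 b
    exact ⟨g₁, g₂, ⟨hdet, hmul⟩, GLOct2_ext hg⟩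
  · rintro ⟨g₁, g₃, h, rfl⟩
    exact ⟨(g₁, g₃, g₃), ⟨h.isometryDet_eq_one, h.isometryDet_right, h.isometryDet_right,
      h.map_mul⟩, h.map_one, fun _ => rfl⟩

theorem covers_blockDiag {g₁ g₃ : Oct ≃ₗᵢ[ℝ] Oct} (h : ∀ a b : Oct, g₃ (a * b) = g₁ a * g₃ b) :
    Covers (blockDiag g₁ g₃) ((LinearIsometryEquiv.refl ℝ ℝ).withLpProdCongr 2 g₃) := fun v => by
  refine WithLp.ofLp_injective 2 (Prod.ext ?_ ?_)
  · change (σ _).fst = (σ v).fst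
    simp
  · change (σ _).snd = g₃ (σ v).snd
    simp [h]

theorem isometryDet_refl_withLpProdCongr (g : Oct ≃ₗᵢ[ℝ] Oct) :
    isometryDet ((LinearIsometryEquiv.refl ℝ ℝ).withLpProdCongr 2 g) = isometryDet g := by
  rw [isometryDet_withLpProdCongr]
  exact (congrArg (· * _) (map_one isometryDet)).trans (one_mul _)

theorem isometryDet_mul_of_blockDiag_mem_SO16 {g₁ g₃ : Oct ≃ₗᵢ[ℝ] Oct}
    (h : blockDiag g₁ g₃ ∈ SO16) : isometryDet g₁ * isometryDet g₃ = 1 :=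
  (isometryDet_withLpProdCongr g₁ g₃).symm.trans h.2

theorem K1_le_Spin9 : K1 ≤ Spin9 := fun g hg => by
  obtain ⟨g₁, g₃, h, rfl⟩ := mem_K1_iff.1 hg
  exact mem_Spin9_iff.2 ⟨_, (isometryDet_refl_withLpProdCongr g₃).trans h.isometryDet_right,
    covers_blockDiag h.map_mul⟩

theorem exists_eq_σ_add_smul_northPole (w : Vec9) (a b : Oct) (h : (2 : ℝ) • (a * b) = w.snd) :
    ∃ t : ℝ, w = σ (Oct2.mk a b) + t • northPole :=
  ⟨w.fst - (σ (Oct2.mk a b)).fst, WithLp.ofLp_injective 2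
    (Prod.ext (by simp [northPole]) (by simp [northPole, h]))⟩

theorem mul_eq_of_covers_blockDiag {g₁ g₃ : Oct ≃ₗᵢ[ℝ] Oct} {ρ : Vec9 ≃ₗᵢ[ℝ] Vec9}
    (hρ : Covers (blockDiag g₁ g₃) ρ) (hpole : ρ northPole = northPole) (hone : g₁ 1 = 1)
    (a b : Oct) : g₃ (a * b) = g₁ a * g₃ b := by
  obtain ⟨t, ht⟩ := exists_eq_σ_add_smul_northPole (σ (Oct2.mk a b)) 1 (a * b) (by simp)
  have h := congrArg (fun w => (ρ w).snd) ht
  simp only [map_add, map_smul, hpole, ← hρ _] at h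
  exact smul_right_injective Oct (two_ne_zero' ℝ)
    (h.trans (by simp [northPole, hone] : _ = (2 : ℝ) • g₃ (a * b))).symm

theorem eq_refl_withLpProdCongr_of_covers_blockDiag {g₁ g₃ : Oct ≃ₗᵢ[ℝ] Oct}
    {ρ : Vec9 ≃ₗᵢ[ℝ] Vec9} (hρ : Covers (blockDiag g₁ g₃) ρ) (hpole : ρ northPole = northPole)
    (hone : g₁ 1 = 1) : ρ = (LinearIsometryEquiv.refl ℝ ℝ).withLpProdCongr 2 g₃ := by
  refine LinearIsometryEquiv.ext fun w => ?_
  obtain ⟨t, ht⟩ := exists_eq_σ_add_smul_northPole w 1 ((2⁻¹ : ℝ) • w.snd) (by simp)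
  rw [ht, map_add, map_add, map_smul, map_smul, hpole, ← hρ,
    ← covers_blockDiag (mul_eq_of_covers_blockDiag hρ hpole hone)]
  congr 2
  exact WithLp.ofLp_injective 2 (Prod.ext rfl g₃.map_zero.symm)

theorem mem_K1_of_mem_Spin9 {g : GLOct2} (hg : g ∈ Spin9)
    (hfix : g • Oct2.mk 1 0 = Oct2.mk 1 0) : g ∈ K1 := by
  obtain ⟨ρ, hdet, hρ⟩ := mem_Spin9_iff.1 hg
  have hσ : σ (Oct2.mk 1 0) = northPole :=
    WithLp.ofLp_injective 2 (Prod.ext (by simp [northPole]) (by simp [northPole]))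
  have hpole : ρ northPole = northPole := by rw [← hσ, ← hρ, hfix]
  obtain ⟨g₁, g₃, rfl⟩ := hρ.exists_eq_blockDiag hpole
  have hone : g₁ 1 = 1 := congrArg Oct2.fst hfix
  have hdet₁ := isometryDet_mul_of_blockDiag_mem_SO16 (Spin9_le_SO16 hg)
  rw [eq_refl_withLpProdCongr_of_covers_blockDiag hρ hpole hone,
    isometryDet_refl_withLpProdCongr] at hdet
  rw [hdet, mul_one] at hdet₁
  exact mem_K1_iff.2 ⟨g₁, g₃, ⟨hdet₁, mul_eq_of_covers_blockDiag hρ hpole hone⟩, rfl⟩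

theorem K1_smul_mk_zero {g : GLOct2} (hg : g ∈ K1) (r : ℝ) :
    g • Oct2.mk (r • 1) 0 = Oct2.mk (r • 1) 0 := by
  obtain ⟨g₁, g₃, h, rfl⟩ := mem_K1_iff.1 hg
  simp [h.map_one]

theorem stabilizer_eq_K1 : Spin9 ⊓ MulAction.stabilizer GLOct2 (Oct2.mk 1 0) = K1 := by
  ext g
  refine ⟨fun ⟨hg, hfix⟩ => mem_K1_of_mem_Spin9 hg hfix, fun hg => ⟨K1_le_Spin9 hg, ?_⟩⟩
  simpa using K1_smul_mk_zero hg 1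

/-! ### Transitivity of `K₁` -/

theorem blockDiag_mem_K1 (e : ImUnit) : blockDiag e.conjBy e.leftMul ∈ K1 :=
  mem_K1_iff.2 ⟨_, _, ⟨e.isometryDet_conjBy, e.leftMul_mul⟩, rfl⟩

theorem ImUnit.conjBy_eq_C {e : ImUnit} {x : Oct} (h : inner ℝ x (e : Oct) = 0) :
    e.conjBy x = C x := by
  rw [conjBy_apply, real_inner_comm, h, mul_zero, zero_smul, add_zero]

/-- A unit vector of imaginary octonions, from a nonzero imaginary octonion. -/
def ImUnit.normalize (x : Oct) (hx : x ∈ Im) (h : x ≠ 0) : ImUnit :=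
  ⟨‖x‖⁻¹ • ⟨x, hx⟩, by
    rw [mem_sphere_zero_iff_norm]
    exact norm_smul_inv_norm (𝕜 := ℝ) (x := (⟨x, hx⟩ : Im)) (by simpa using h)⟩

theorem ImUnit.exists_conjBy_eq {x x' : Oct} (hinner : inner ℝ x 1 = (inner ℝ x' 1 : ℝ))
    (hnorm : ‖x‖ = ‖x'‖) : ∃ e : ImUnit, e.conjBy x = x' := by
  suffices h : ∃ e : ImUnit, unitReflection e.toSphere x = C x' by
    obtain ⟨e, he⟩ := h
    refine ⟨e, (congrArg conjIsometry he).trans ?_⟩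
    rw [conjIsometry_apply, C_C]
  by_cases h : x = C x'
  · obtain ⟨e, he⟩ := exists_imUnit_orthogonal ![x] (by norm_num)
    refine ⟨e, ?_⟩
    have he' : inner ℝ (e.toSphere : Oct) x = 0 := (real_inner_comm _ _).trans (he 0)
    rw [unitReflection_apply, he', mul_zero, zero_smul, sub_zero, h]
  · refine ⟨normalize (x - C x') ?_ (sub_ne_zero.2 h), ?_⟩
    · rw [mem_Im, inner_sub_left, inner_C_left, C_one, hinner, sub_self]
    · have hspan : (ℝ ∙ (‖x - C x'‖⁻¹ • (x - C x'))) = ℝ ∙ (x - C x') :=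
        Submodule.span_singleton_smul_eq
          (inv_ne_zero (norm_ne_zero_iff.2 (sub_ne_zero.2 h))).isUnit _
      change (ℝ ∙ (‖x - C x'‖⁻¹ • (x - C x')))ᗮ.reflection x = C x'
      simp_rw [hspan]
      exact Submodule.reflection_sub (hnorm.trans (norm_C x').symm)

theorem exists_mem_K1_fst {x x' : Oct} (hinner : inner ℝ x 1 = (inner ℝ x' 1 : ℝ))
    (hnorm : ‖x‖ = ‖x'‖) (y : Oct) : ∃ k ∈ K1, ∃ y', k • Oct2.mk x y = Oct2.mk x' y' := by
  obtain ⟨e, rfl⟩ := ImUnit.exists_conjBy_eq hinner hnorm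
  exact ⟨_, blockDiag_mem_K1 e, _, rfl⟩

theorem exists_mul_mul_eq (x : Oct) {y y' : Oct} (hy : y ≠ 0) (hnorm : ‖y‖ = ‖y'‖) :
    ∃ e f : ImUnit, inner ℝ x (e : Oct) = 0 ∧ inner ℝ x (f : Oct) = 0 ∧
      (e : Oct) * (f * y) = y' := by
  have hy' : ‖y‖ ^ 2 ≠ 0 := pow_ne_zero 2 (norm_ne_zero_iff.2 hy)
  obtain ⟨e, he⟩ := exists_imUnit_orthogonal ![x, y * C y', (x * y) * C y'] (by norm_num)
  set f : Oct := -((‖y‖ ^ 2)⁻¹ • ((e * y') * C y)) with hf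
  have hinner (v : Oct) (hv : inner ℝ ((v * y) * C y') (e : Oct) = 0) : inner ℝ v f = 0 := by
    rw [hf, inner_neg_right, real_inner_smul_right, ← inner_mul_right_C, real_inner_comm,
      inner_mul_right_C, real_inner_comm, hv, mul_zero, neg_zero]
  have hmem : f ∈ Im := by
    rw [mem_Im, real_inner_comm]
    exact hinner 1 (by rw [one_mul]; exact he 1)
  have hnorm_f : ‖f‖ = 1 := by
    rw [hf, norm_neg, norm_smul, norm_mul, norm_mul, e.norm_coe, norm_C, ← hnorm, one_mul, ← sq,
      norm_inv, norm_pow, norm_norm, inv_mul_cancel₀ hy']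
  refine ⟨e, ⟨⟨f, hmem⟩, mem_sphere_zero_iff_norm.2 hnorm_f⟩, he 0, hinner x (he 2), ?_⟩
  have hmul := mul_mul_C (C y) (e * y')
  rw [C_C, norm_C] at hmul
  change (e : Oct) * (f * y) = y'
  rw [hf, neg_mul, smul_mul_assoc, hmul, inv_smul_smul₀ hy', mul_neg, e.mul_mul_self, neg_neg]

theorem exists_mem_K1_snd (x : Oct) {y y' : Oct} (hnorm : ‖y‖ = ‖y'‖) :
    ∃ k ∈ K1, k • Oct2.mk x y = Oct2.mk x y' := by
  by_cases hy : y = 0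
  · have hy' : y' = 0 := by rw [← norm_eq_zero, ← hnorm, hy, norm_zero]
    exact ⟨1, one_mem _, by rw [one_smul, hy, hy']⟩
  · obtain ⟨e, f, he, hf, hef⟩ := exists_mul_mul_eq x hy hnorm
    refine ⟨_, mul_mem (blockDiag_mem_K1 e) (blockDiag_mem_K1 f), ?_⟩
    have hCe : inner ℝ (C x) (e : Oct) = 0 := by
      rw [inner_C_left, e.C_coe, inner_neg_right, he, neg_zero]
    rw [mul_smul, blockDiag_smul, blockDiag_smul]
    ext1 <;> simp only [Oct2.mk_fst, Oct2.mk_snd]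
    · rw [ImUnit.conjBy_eq_C hf, ImUnit.conjBy_eq_C hCe, C_C]
    · exact hef

theorem exists_mem_K1 {v w : Oct2} (hinner : inner ℝ v.fst 1 = (inner ℝ w.fst 1 : ℝ))
    (hfst : ‖v.fst‖ = ‖w.fst‖) (hsnd : ‖v.snd‖ = ‖w.snd‖) : ∃ k ∈ K1, k • v = w := by
  obtain ⟨k, hk, y, hkv⟩ := exists_mem_K1_fst hinner hfst v.snd
  have hy : ‖y‖ = ‖w.snd‖ := by
    obtain ⟨g₁, g₃, -, rfl⟩ := mem_K1_iff.1 hk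
    rw [← hsnd, ← g₃.norm_map v.snd]
    exact congrArg (‖·.snd‖) hkv.symm
  obtain ⟨k', hk', hkw⟩ := exists_mem_K1_snd w.fst hy
  exact ⟨k' * k, mul_mem hk' hk, (mul_smul _ _ _).trans ((congrArg (k' • ·) hkv).trans hkw)⟩

/-! ### Orbits of pairs -/

theorem q20_eq (z : Oct2 × Oct2) : q20 z = inner ℝ z.1 z.1 := by
  rw [real_inner_self_eq_norm_sq, Oct2.norm_sq_eq, q20]

theorem q11_eq (z : Oct2 × Oct2) : q11 z = inner ℝ z.1 z.2 := (Oct2.inner_eq z.1 z.2).symm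

theorem q02_eq (z : Oct2 × Oct2) : q02 z = inner ℝ z.2 z.2 := by
  rw [real_inner_self_eq_norm_sq, Oct2.norm_sq_eq, q02]

/-- The four basic invariants of a pair of vectors of `O²`. -/
def invariants (z : Oct2 × Oct2) : EuclideanSpace ℝ (Fin 4) := !₂[q20 z, q11 z, q02 z, q22 z]

theorem invariants_eq_iff {z : Oct2 × Oct2} {a : EuclideanSpace ℝ (Fin 4)} : invariants z = a ↔
    q20 z = a 0 ∧ q11 z = a 1 ∧ q02 z = a 2 ∧ q22 z = a 3 := by
  simp [invariants, PiLp.ext_iff, Fin.forall_fin_succ]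

theorem invariants_smul (g : Spin9) (z : Oct2 × Oct2) : invariants (g • z) = invariants z := by
  have hinner (v w : Oct2) : inner ℝ (g • v) (g • w) = (inner ℝ v w : ℝ) :=
    inner_map_map_of_norm_map (((g : GLOct2) : Oct2 →L[ℝ] Oct2) : Oct2 →ₗ[ℝ] Oct2)
      (norm_smul_Spin9 g) v w
  obtain ⟨ρ, -, hρ⟩ := exists_covers_of_mem_Spin9 g.2
  refine invariants_eq_iff.2 ⟨?_, ?_, ?_, ?_⟩
  · exact (q20_eq _).trans ((hinner _ _).trans (q20_eq z).symm)
  · exact (q11_eq _).trans ((hinner _ _).trans (q11_eq z).symm)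
  · exact (q02_eq _).trans ((hinner _ _).trans (q02_eq z).symm)
  · change inner ℝ (σ ((g : GLOct2) • z.1)) (σ ((g : GLOct2) • z.2)) = inner ℝ (σ z.1) (σ z.2)
    rw [hρ, hρ, ρ.inner_map_map]

theorem invariants_mk (t : ℝ) (v : Oct2) : invariants (Oct2.mk (t • 1) 0, v) =
    !₂[t ^ 2, t * inner ℝ v.fst 1, ‖v.fst‖ ^ 2 + ‖v.snd‖ ^ 2,
      t ^ 2 * (‖v.fst‖ ^ 2 - ‖v.snd‖ ^ 2)] := by
  rw [invariants, q20, q11, q02, q22, Vec9.inner_eq]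
  simp [norm_smul, real_inner_smul_left, real_inner_comm]

theorem exists_K1_smul_eq {t : ℝ} (ht : t ≠ 0) {v w : Oct2}
    (h : invariants (Oct2.mk (t • 1) 0, v) = invariants (Oct2.mk (t • 1) 0, w)) :
    ∃ k ∈ K1, k • v = w := by
  rw [invariants_mk, invariants_mk] at h
  have hcoord := fun i => congrArg (fun a : EuclideanSpace ℝ (Fin 4) => a i) h
  have hinner := mul_left_cancel₀ ht (hcoord 1)
  have hsum : ‖v.fst‖ ^ 2 + ‖v.snd‖ ^ 2 = ‖w.fst‖ ^ 2 + ‖w.snd‖ ^ 2 := hcoord 2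
  have hdiff := mul_left_cancel₀ (pow_ne_zero 2 ht) (hcoord 3)
  refine exists_mem_K1 hinner ?_ ?_ <;>
  · rw [← pow_left_inj₀ (norm_nonneg _) (norm_nonneg _) two_ne_zero]
    linarith

theorem exists_smul_eq_of_invariants_eq {z w : Oct2 × Oct2} (h : invariants z = invariants w) :
    ∃ g : Spin9, g • z = w := by
  obtain ⟨hfst, -, hsnd, -⟩ : q20 z = q20 w ∧ _ ∧ q02 z = q02 w ∧ _ := invariants_eq_iff.1 h
  rw [q20_eq, q20_eq] at hfst
  rw [q02_eq, q02_eq] at hsnd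
  by_cases hz : z.1 = 0
  · obtain ⟨g, hg⟩ := exists_smul_eq_of_norm_eq (norm_eq_of_inner_self_eq hsnd)
    have hw : w.1 = 0 := by rw [← inner_self_eq_zero (𝕜 := ℝ), ← hfst, hz, inner_zero_left]
    exact ⟨g, Prod.ext (by rw [Prod.smul_fst, hz, hw, smul_zero]) hg⟩
  · obtain ⟨a, ha, haz⟩ := exists_smul_eq_mk_norm z.1
    obtain ⟨b, hb, hbw⟩ := exists_smul_eq_mk_norm w.1
    rw [← norm_eq_of_inner_self_eq hfst] at hbw
    have ha' := invariants_smul ⟨a, ha⟩ z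
    have hb' := invariants_smul ⟨b, hb⟩ w
    rw [show (⟨a, ha⟩ : Spin9) • z = (_, a • z.2) from Prod.ext haz rfl] at ha'
    rw [show (⟨b, hb⟩ : Spin9) • w = (_, b • w.2) from Prod.ext hbw rfl] at hb'
    obtain ⟨k, hk, hkz⟩ :=
      exists_K1_smul_eq (norm_ne_zero_iff.2 hz) (ha'.trans (h.trans hb'.symm))
    refine ⟨⟨b⁻¹ * (k * a), mul_mem (inv_mem hb) (mul_mem (K1_le_Spin9 hk) ha)⟩, ?_⟩
    rw [Subgroup.mk_smul, mul_smul, inv_smul_eq_iff, mul_smul]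
    exact Prod.ext ((congrArg (k • ·) haz).trans ((K1_smul_mk_zero hk _).trans hbw.symm)) hkz

theorem orbit_eq_invariants_preimage (z : Oct2 × Oct2) :
    MulAction.orbit Spin9 z = {w | invariants w = invariants z} := by
  ext w
  exact ⟨fun ⟨g, hg⟩ => hg ▸ invariants_smul g z,
    fun h => exists_smul_eq_of_invariants_eq (Eq.symm h)⟩

/-! ### The generic orbit of pairs -/

theorem q22_eq (z : Oct2 × Oct2) : q22 z =
    (inner ℝ z.1.fst z.1.fst - inner ℝ z.1.snd z.1.snd) *
      (inner ℝ z.2.fst z.2.fst - inner ℝ z.2.snd z.2.snd) +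
    4 * inner ℝ (z.1.fst * z.1.snd) (z.2.fst * z.2.snd) := by
  rw [q22, Vec9.inner_eq, σ_fst, σ_fst, σ_snd, σ_snd, real_inner_smul_left, real_inner_smul_right]
  simp only [real_inner_self_eq_norm_sq]
  ring

/-- The first coordinate of `O²`. -/
def fstₗ : Oct2 →ₗ[ℝ] Oct := ⟨⟨Oct2.fst, fun _ _ => rfl⟩, fun _ _ => rfl⟩

/-- The second coordinate of `O²`. -/
def sndₗ : Oct2 →ₗ[ℝ] Oct := ⟨⟨Oct2.snd, fun _ _ => rfl⟩, fun _ _ => rfl⟩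

theorem inner_mem_polyFun {V E : Type} [AddCommGroup V] [Module ℝ V] [NormedAddCommGroup E]
    [InnerProductSpace ℝ E] [FiniteDimensional ℝ E] {F G : V → E} (hF : IsPolyMap F)
    (hG : IsPolyMap G) : (fun z => inner ℝ (F z) (G z) : V → ℝ) ∈ polyFun V :=
  (hF.bilin hG (innerₗ E)).mem_polyFun

theorem q20_mem_polyFun : q20 ∈ polyFun (Oct2 × Oct2) := by
  rw [show q20 = _ from funext q20_eq]
  exact inner_mem_polyFun (isPolyMap_linearMap (LinearMap.fst ℝ Oct2 Oct2))
    (isPolyMap_linearMap (LinearMap.fst ℝ Oct2 Oct2))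

theorem q11_mem_polyFun : q11 ∈ polyFun (Oct2 × Oct2) := by
  rw [show q11 = _ from funext q11_eq]
  exact inner_mem_polyFun (isPolyMap_linearMap (LinearMap.fst ℝ Oct2 Oct2))
    (isPolyMap_linearMap (LinearMap.snd ℝ Oct2 Oct2))

theorem q02_mem_polyFun : q02 ∈ polyFun (Oct2 × Oct2) := by
  rw [show q02 = _ from funext q02_eq]
  exact inner_mem_polyFun (isPolyMap_linearMap (LinearMap.snd ℝ Oct2 Oct2))
    (isPolyMap_linearMap (LinearMap.snd ℝ Oct2 Oct2))

theorem q22_mem_polyFun : q22 ∈ polyFun (Oct2 × Oct2) := by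
  have hx₁ := isPolyMap_linearMap (fstₗ ∘ₗ LinearMap.fst ℝ Oct2 Oct2)
  have hy₁ := isPolyMap_linearMap (sndₗ ∘ₗ LinearMap.fst ℝ Oct2 Oct2)
  have hx₂ := isPolyMap_linearMap (fstₗ ∘ₗ LinearMap.snd ℝ Oct2 Oct2)
  have hy₂ := isPolyMap_linearMap (sndₗ ∘ₗ LinearMap.snd ℝ Oct2 Oct2)
  rw [show q22 = _ from funext q22_eq]
  exact add_mem
    (mul_mem (sub_mem (inner_mem_polyFun hx₁ hx₁) (inner_mem_polyFun hy₁ hy₁))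
      (sub_mem (inner_mem_polyFun hx₂ hx₂) (inner_mem_polyFun hy₂ hy₂)))
    (Subalgebra.smul_mem _ (inner_mem_polyFun (hx₁.bilin hy₁ (LinearMap.mul ℝ Oct))
      (hx₂.bilin hy₂ (LinearMap.mul ℝ Oct))) 4)

theorem contDiff_invariants : ContDiff ℝ ∞ invariants := by
  rw [contDiff_euclidean]
  intro i
  fin_cases i
  exacts [contDiff_of_mem_polyFun q20_mem_polyFun, contDiff_of_mem_polyFun q11_mem_polyFun,
    contDiff_of_mem_polyFun q02_mem_polyFun, contDiff_of_mem_polyFun q22_mem_polyFun]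

theorem differentiable_invariants : Differentiable ℝ invariants :=
  contDiff_invariants.differentiable (by simp)

/-- The polynomial vanishing on the singular orbits. -/
def disc (z : Oct2 × Oct2) : ℝ :=
  q20 z * (q20 z * q02 z - q22 z) * (q20 z * q02 z + q22 z - 2 * q11 z ^ 2)

theorem disc_mem_polyFun : disc ∈ polyFun (Oct2 × Oct2) :=
  mul_mem (mul_mem q20_mem_polyFun (sub_mem (mul_mem q20_mem_polyFun q02_mem_polyFun)
    q22_mem_polyFun))
    (sub_mem (add_mem (mul_mem q20_mem_polyFun q02_mem_polyFun) q22_mem_polyFun)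
      (Subalgebra.smul_mem _ (pow_mem q11_mem_polyFun 2) 2))

theorem disc_eq_of_invariants_eq {z w : Oct2 × Oct2} (h : invariants w = invariants z) :
    disc w = disc z :=
  congrArg (fun a : EuclideanSpace ℝ (Fin 4) =>
    a 0 * (a 0 * a 2 - a 3) * (a 0 * a 2 + a 3 - 2 * a 1 ^ 2)) h

/-- The interior of the image of `invariants`. -/
def regularInvariants : Set (EuclideanSpace ℝ (Fin 4)) :=
  {a | 0 < a 0 ∧ 0 < a 0 * a 2 - a 3 ∧ 0 < a 0 * a 2 + a 3 - 2 * a 1 ^ 2}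

theorem isOpen_regularInvariants : IsOpen regularInvariants := by
  unfold regularInvariants
  simp only [Set.ofPred_and]
  refine .inter ?_ (.inter ?_ ?_) <;> exact isOpen_lt continuous_const (by fun_prop)

theorem disc_mk (t : ℝ) (v : Oct2) : disc (Oct2.mk (t • 1) 0, v) =
    t ^ 2 * (2 * t ^ 2 * ‖v.snd‖ ^ 2) * (2 * t ^ 2 * (‖v.fst‖ ^ 2 - inner ℝ v.fst 1 ^ 2)) := by
  obtain ⟨h20, h11, h02, h22⟩ := invariants_eq_iff.1 (invariants_mk t v)
  rw [disc, h20, h11, h02, h22]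
  simp only [Matrix.cons_val]
  ring

theorem invariants_mk_mem_regularInvariants {t : ℝ} {v : Oct2}
    (h : disc (Oct2.mk (t • 1) 0, v) ≠ 0) :
    invariants (Oct2.mk (t • 1) 0, v) ∈ regularInvariants := by
  have hcauchy : 0 ≤ ‖v.fst‖ ^ 2 - inner ℝ v.fst 1 ^ 2 := by
    rw [sub_nonneg, sq_le_sq, abs_norm]
    simpa using abs_real_inner_le_norm v.fst 1
  rw [disc_mk, mul_ne_zero_iff, mul_ne_zero_iff] at h
  obtain ⟨⟨h₀, h₁⟩, h₂⟩ := h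
  rw [invariants_mk]
  refine ⟨lt_of_le_of_ne' (sq_nonneg t) h₀, (lt_of_le_of_ne' (by positivity) h₁).trans_eq ?_,
    (lt_of_le_of_ne' (mul_nonneg (by positivity) hcauchy) h₂).trans_eq ?_⟩ <;>
  · simp only [Matrix.cons_val]
    ring

theorem invariants_mem_regularInvariants {z : Oct2 × Oct2} (hz : disc z ≠ 0) :
    invariants z ∈ regularInvariants := by
  obtain ⟨g, hg, hgz⟩ := exists_smul_eq_mk_norm z.1
  have hinv : invariants (Oct2.mk (‖z.1‖ • 1) 0, g • z.2) = invariants z := by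
    rw [← invariants_smul ⟨g, hg⟩ z]
    exact congrArg (fun w => invariants (w, g • z.2)) hgz.symm
  rw [← disc_eq_of_invariants_eq hinv] at hz
  exact hinv ▸ invariants_mk_mem_regularInvariants hz

theorem invariants_mk_mk (e : ImUnit) (t r m n : ℝ) :
    invariants (Oct2.mk (t • 1) 0, Oct2.mk (r • 1 + m • (e : Oct)) (n • 1)) =
      !₂[t ^ 2, t * r, r ^ 2 + m ^ 2 + n ^ 2, t ^ 2 * (r ^ 2 + m ^ 2 - n ^ 2)] := by
  have he : inner ℝ (e : Oct) 1 = 0 := mem_Im.1 e.1.2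
  have hinner : inner ℝ (r • (1 : Oct) + m • (e : Oct)) 1 = r := by
    simp [inner_add_left, real_inner_smul_left, he]
  have hnorm : ‖r • (1 : Oct) + m • (e : Oct)‖ ^ 2 = r ^ 2 + m ^ 2 := by
    simp [norm_add_sq_real, norm_smul, real_inner_smul_left, real_inner_smul_right,
      real_inner_comm, he, e.norm_coe]
  rw [invariants_mk, Oct2.mk_fst, Oct2.mk_snd, hinner, hnorm, norm_smul, norm_one, mul_one,
    Real.norm_eq_abs, sq_abs]

/-- A section of `invariants` over `regularInvariants`, for an imaginary unit `e`, obtained by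
solving `invariants_mk_mk` for the positive square roots `t`, `m` and `n`. -/
def slice (e : ImUnit) (a : EuclideanSpace ℝ (Fin 4)) : Oct2 × Oct2 :=
  (Oct2.mk (√(a 0) • 1) 0,
    Oct2.mk ((a 1 / √(a 0)) • 1 + √((a 0 * a 2 + a 3 - 2 * a 1 ^ 2) / (2 * a 0)) • (e : Oct))
      (√((a 0 * a 2 - a 3) / (2 * a 0)) • 1))

theorem invariants_slice (e : ImUnit) {a : EuclideanSpace ℝ (Fin 4)} (ha : a ∈ regularInvariants) :
    invariants (slice e a) = a := by
  obtain ⟨h₀, h₁, h₂⟩ := ha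
  rw [slice, invariants_mk_mk, div_pow, Real.sq_sqrt h₀.le, Real.sq_sqrt (by positivity),
    Real.sq_sqrt (by positivity), mul_div_cancel₀ _ (Real.sqrt_pos.2 h₀).ne']
  have hthird : a 1 ^ 2 / a 0 + (a 0 * a 2 + a 3 - 2 * a 1 ^ 2) / (2 * a 0) +
      (a 0 * a 2 - a 3) / (2 * a 0) = a 2 := by
    field_simp
    ring
  have hfourth : a 0 * (a 1 ^ 2 / a 0 + (a 0 * a 2 + a 3 - 2 * a 1 ^ 2) / (2 * a 0) -
      (a 0 * a 2 - a 3) / (2 * a 0)) = a 3 := by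
    field_simp
    ring
  rw [hthird, hfourth]
  ext i
  fin_cases i <;> rfl

theorem differentiableAt_slice (e : ImUnit) {a : EuclideanSpace ℝ (Fin 4)}
    (ha : a ∈ regularInvariants) : DifferentiableAt ℝ (slice e) a := by
  obtain ⟨h₀, h₁, h₂⟩ := ha
  have hslice : slice e = fun a : EuclideanSpace ℝ (Fin 4) => (√(a 0) • Oct2.mk 1 0,
      (a 1 / √(a 0)) • Oct2.mk 1 0 + √((a 0 * a 2 + a 3 - 2 * a 1 ^ 2) / (2 * a 0)) • Oct2.mk e 0 +
        √((a 0 * a 2 - a 3) / (2 * a 0)) • Oct2.mk 0 1) := by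
    ext a : 1
    refine Prod.ext ?_ ?_ <;> ext1 <;> simp [slice]
  rw [hslice]
  fun_prop (disch := positivity)

theorem surjective_fderiv_invariants_slice (e : ImUnit) {a : EuclideanSpace ℝ (Fin 4)}
    (ha : a ∈ regularInvariants) : Function.Surjective (fderiv ℝ invariants (slice e a)) := by
  have hid : invariants ∘ slice e =ᶠ[nhds a] id :=
    Filter.eventuallyEq_of_mem (isOpen_regularInvariants.mem_nhds ha) fun _ => invariants_slice e
  have hcomp := hid.fderiv_eq (𝕜 := ℝ)
  rw [fderiv_comp a (differentiable_invariants _) (differentiableAt_slice e ha), fderiv_id] at hcomp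
  exact fun b => ⟨_, DFunLike.congr_fun hcomp b⟩

theorem surjective_fderiv_invariants {z : Oct2 × Oct2} (hz : disc z ≠ 0) :
    Function.Surjective (fderiv ℝ invariants z) := by
  have hreg := invariants_mem_regularInvariants hz
  obtain ⟨e⟩ := (inferInstance : Nonempty ImUnit)
  obtain ⟨g, hg⟩ := exists_smul_eq_of_invariants_eq (invariants_slice e hreg).symm
  let G : Oct2 × Oct2 →L[ℝ] Oct2 × Oct2 :=
    ((g : GLOct2) : Oct2 →L[ℝ] Oct2).prodMap ((g : GLOct2) : Oct2 →L[ℝ] Oct2)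
  have hinv : invariants ∘ G = invariants := funext (invariants_smul g)
  have hGz : G z = slice e (invariants z) := hg
  have hcomp : fderiv ℝ invariants z = fderiv ℝ invariants (G z) ∘L G := by
    conv_lhs =>
      rw [← hinv, fderiv_comp z (differentiable_invariants _) G.differentiableAt, G.fderiv]
  rw [hcomp, hGz, ContinuousLinearMap.coe_comp]
  exact (surjective_fderiv_invariants_slice e hreg).comp (MulAction.surjective g)

theorem disc_ne_zero : disc ≠ 0 := by
  intro h
  obtain ⟨e⟩ := (inferInstance : Nonempty ImUnit)
  have hreg : (!₂[1, 0, 2, 0] : EuclideanSpace ℝ (Fin 4)) ∈ regularInvariants := by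
    change (0 : ℝ) < 1 ∧ (0 : ℝ) < 1 * 2 - 0 ∧ (0 : ℝ) < 1 * 2 + 0 - 2 * 0 ^ 2
    norm_num
  obtain ⟨h20, h11, h02, h22⟩ := invariants_eq_iff.1 (invariants_slice e hreg)
  have hdisc := congrFun h (slice e !₂[1, 0, 2, 0])
  rw [disc, h20, h11, h02, h22] at hdisc
  change (1 : ℝ) * (1 * 2 - 0) * (1 * 2 + 0 - 2 * 0 ^ 2) = 0 at hdisc
  norm_num at hdisc

theorem isSubmanifoldOfCodim_orbit {z : Oct2 × Oct2} (hz : disc z ≠ 0) :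
    IsSubmanifoldOfCodim 4 (MulAction.orbit Spin9 z) := by
  rw [orbit_eq_invariants_preimage]
  intro p hp
  refine ⟨{x | disc x ≠ 0}, fun x => invariants x - invariants z,
    isOpen_ne_fun ((contDiff_of_mem_polyFun disc_mem_polyFun (n := 0)).continuous) continuous_const,
    (disc_eq_of_invariants_eq hp).trans_ne hz,
    (contDiff_invariants.sub contDiff_const).contDiffOn, fun x hx => ?_, ?_⟩
  · rw [fderiv_sub_const]
    exact surjective_fderiv_invariants hx
  · ext x
    simp only [Set.mem_inter_iff, Set.mem_ofPred_eq, sub_eq_zero]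
    exact and_comm

/-! ### Invariant polynomials on `O²` -/

theorem q_eq (v : Oct2) : q v = ‖v‖ ^ 2 := (Oct2.norm_sq_eq v).symm

theorem q_mem_invPoly : q ∈ invPoly := by
  refine ⟨?_, fun g v => by rw [q_eq, q_eq, norm_smul_Spin9]⟩
  rw [show q = fun v : Oct2 => inner ℝ v v from funext fun v =>
    (q_eq v).trans (real_inner_self_eq_norm_sq v).symm]
  exact inner_mem_polyFun (isPolyMap_linearMap LinearMap.id) (isPolyMap_linearMap LinearMap.id)

theorem exists_eq_eval_norm_of_mem_invPoly {f : Oct2 → ℝ} (hf : f ∈ invPoly) :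
    ∃ p : Polynomial ℝ, ∀ (v : Oct2) (t : ℝ), |t| = ‖v‖ → f v = p.eval t := by
  have hnorm : ‖Oct2.mk 1 0‖ = 1 := by
    rw [← pow_left_inj₀ (norm_nonneg _) zero_le_one two_ne_zero, Oct2.norm_sq_eq]
    simp
  obtain ⟨p, hp⟩ := exists_eval_eq_of_mem_polyFun hf.1 (Oct2.mk 1 0)
  refine ⟨p, fun v t ht => ?_⟩
  obtain ⟨g, hg⟩ := exists_smul_eq_of_norm_eq (v := v) (w := t • Oct2.mk 1 0)
    (by rw [norm_smul, hnorm, mul_one, Real.norm_eq_abs, ht])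
  rw [← hp, ← hg, hf.2]

theorem invPoly_eq_adjoin : invPoly = Algebra.adjoin ℝ {q} := by
  refine le_antisymm (fun f hf => ?_)
    (Algebra.adjoin_le (Set.singleton_subset_iff.2 q_mem_invPoly))
  obtain ⟨p, hp⟩ := exists_eq_eval_norm_of_mem_invPoly hf
  obtain ⟨r, hr⟩ := exists_eval_add_eval_neg_eq_eval_sq p
  have hfr : f = Polynomial.aeval q (Polynomial.C (1 / 2) * r) := by
    ext v
    have heval : Polynomial.aeval q (Polynomial.C (1 / 2) * r) v = 1 / 2 * r.eval (q v) := by simp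
    rw [heval, q_eq, ← hr, ← hp v ‖v‖ (abs_norm _), ← hp v (-‖v‖) (by rw [abs_neg, abs_norm])]
    ring
  rw [hfr]
  exact Polynomial.aeval_mem_adjoin_singleton ℝ q

/-! ### The spin representation of `Cℓ(ℝ⁷)` on the octonions -/

section Spin7

open CliffordAlgebra

/-- An identification of `ℝ⁷` with the imaginary octonions. -/
def imEquiv : EuclideanSpace ℝ (Fin 7) ≃ₗᵢ[ℝ] Im :=
  ((stdOrthonormalBasis ℝ Im).reindex (finCongr finrank_Im)).repr.symm

theorem Q7_apply (v : EuclideanSpace ℝ (Fin 7)) : Q7 v = -‖v‖ ^ 2 := by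
  rw [← real_inner_self_eq_norm_sq]
  rfl

theorem mul_mul_self_of_mem_Im {x : Oct} (hx : x ∈ Im) (y : Oct) : x * (x * y) = -‖x‖ ^ 2 • y := by
  rw [neg_smul, ← C_mul_mul, mem_Im_iff_C.1 hx, neg_mul, neg_neg]

/-- The action of `Cℓ(ℝ⁷)` on the octonions in which a vector acts by left multiplication. -/
def spinRep : CliffordAlgebra Q7 →ₐ[ℝ] Module.End ℝ Oct :=
  CliffordAlgebra.lift Q7
    ⟨LinearMap.mul ℝ Oct ∘ₗ Im.subtype ∘ₗ imEquiv.toLinearEquiv.toLinearMap, fun v =>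
      LinearMap.ext fun x => by
        rw [Q7_apply, ← imEquiv.norm_map]
        exact mul_mul_self_of_mem_Im (imEquiv v).2 x⟩

theorem spinRep_ι (v : EuclideanSpace ℝ (Fin 7)) (x : Oct) :
    spinRep (ι Q7 v) x = (imEquiv v : Oct) * x := by
  rw [spinRep, CliffordAlgebra.lift_ι_apply]
  rfl

theorem algebraMap_Q7_injective : Function.Injective (algebraMap ℝ (CliffordAlgebra Q7)) :=
  fun r s h => smul_left_injective ℝ (one_ne_zero (α := Oct))
    (by simpa using congrArg (fun x => spinRep x 1) h)

/-! ### `Spin(7)` as the group of even products of unit vectors -/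

namespace ImUnit

/-- An imaginary unit, as a unit vector of `ℝ⁷` in the Clifford algebra. -/
def toClifford (e : ImUnit) : CliffordAlgebra Q7 := ι Q7 (imEquiv.symm e)

theorem toClifford_mul_self (e : ImUnit) : e.toClifford * e.toClifford = -1 := by
  rw [toClifford, ι_sq_scalar, Q7_apply, imEquiv.symm.norm_map, norm_eq_of_mem_sphere, one_pow,
    map_neg, map_one]

theorem toClifford_mem_pinGroup (e : ImUnit) : e.toClifford ∈ pinGroup Q7 := by
  let X : (CliffordAlgebra Q7)ˣ := ⟨e.toClifford, -e.toClifford,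
    by rw [mul_neg, toClifford_mul_self, neg_neg], by rw [neg_mul, toClifford_mul_self, neg_neg]⟩
  refine pinGroup.mem_iff.2 ⟨⟨X, Subgroup.subset_closure ⟨_, rfl⟩, rfl⟩, ?_⟩
  have hstar : star e.toClifford = -e.toClifford := star_ι _
  rw [Unitary.mem_iff, hstar, neg_mul, mul_neg, toClifford_mul_self, neg_neg]
  exact ⟨rfl, rfl⟩

end ImUnit

/-- The product in the Clifford algebra of a list of unit vectors. -/
def cliffordProd (l : List ImUnit) : CliffordAlgebra Q7 := (l.map ImUnit.toClifford).prod

theorem cliffordProd_cons (e : ImUnit) (l : List ImUnit) :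
    cliffordProd (e :: l) = e.toClifford * cliffordProd l := by
  rw [cliffordProd, List.map_cons, List.prod_cons, cliffordProd]

theorem cliffordProd_append (l l' : List ImUnit) :
    cliffordProd (l ++ l') = cliffordProd l * cliffordProd l' := by
  rw [cliffordProd, List.map_append, List.prod_append, cliffordProd, cliffordProd]

theorem cliffordProd_mem_pinGroup (l : List ImUnit) : cliffordProd l ∈ pinGroup Q7 :=
  list_prod_mem fun x hx => by
    obtain ⟨e, -, rfl⟩ := List.mem_map.1 hx
    exact e.toClifford_mem_pinGroup

theorem cliffordProd_mem_evenOdd (l : List ImUnit) :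
    cliffordProd l ∈ evenOdd Q7 (l.length : ZMod 2) := by
  induction l with
  | nil => simpa [cliffordProd] using SetLike.one_mem_graded (evenOdd Q7)
  | cons e l ih =>
    rw [cliffordProd_cons, List.length_cons, Nat.cast_add, Nat.cast_one, add_comm]
    exact SetLike.mul_mem_graded (ι_mem_evenOdd_one Q7 _) ih

theorem cliffordProd_mem_Spin7 {l : List ImUnit} (hl : Even l.length) : cliffordProd l ∈ Spin7 := by
  refine spinGroup.mem_iff.2 ⟨cliffordProd_mem_pinGroup l, ?_⟩
  have hmem := cliffordProd_mem_evenOdd l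
  rwa [ZMod.natCast_eq_zero_iff_even.2 hl] at hmem

theorem spinRep_cliffordProd (l : List ImUnit) (x : Oct) :
    spinRep (cliffordProd l) x = (l.map ImUnit.leftMul).prod x := by
  induction l with
  | nil => exact LinearMap.congr_fun (map_one spinRep) x
  | cons e l ih =>
    rw [cliffordProd_cons, map_mul, Module.End.mul_apply, ih, ImUnit.toClifford, spinRep_ι,
      imEquiv.apply_symm_apply, List.map_cons, List.prod_cons]
    rfl

theorem exists_ι_eq_smul_toClifford (v : EuclideanSpace ℝ (Fin 7)) :
    ∃ (r : ℝ) (e : ImUnit), ι Q7 v = r • e.toClifford := by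
  by_cases hv : v = 0
  · obtain ⟨e⟩ := (inferInstance : Nonempty ImUnit)
    exact ⟨0, e, by rw [hv, map_zero, zero_smul]⟩
  · have hv' : ‖v‖ ≠ 0 := norm_ne_zero_iff.2 hv
    refine ⟨‖v‖, ⟨‖v‖⁻¹ • imEquiv v, ?_⟩, ?_⟩
    · rw [mem_sphere_zero_iff_norm, norm_smul, norm_inv, norm_norm, imEquiv.norm_map,
        inv_mul_cancel₀ hv']
    · rw [ImUnit.toClifford, map_smul, imEquiv.symm_apply_apply, map_smul, smul_inv_smul₀ hv']

theorem exists_eq_smul_cliffordProd {X : (CliffordAlgebra Q7)ˣ} (hX : X ∈ lipschitzGroup Q7) :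
    ∃ (r : ℝ) (l : List ImUnit), (X : CliffordAlgebra Q7) = r • cliffordProd l := by
  induction hX using Subgroup.closure_induction'' with
  | mem X hX =>
    obtain ⟨v, hv⟩ := hX
    obtain ⟨r, e, hre⟩ := exists_ι_eq_smul_toClifford v
    exact ⟨r, [e], by rw [← hv, hre, cliffordProd, List.map_singleton, List.prod_singleton]⟩
  | inv_mem X hX =>
    obtain ⟨v, hv⟩ := hX
    obtain ⟨r, e, hre⟩ := exists_ι_eq_smul_toClifford v
    rw [hv] at hre
    have : Nontrivial (CliffordAlgebra Q7) := algebraMap_Q7_injective.nontrivial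
    have hr : r ≠ 0 := fun hr => X.ne_zero (by rw [hre, hr, zero_smul])
    refine ⟨-r⁻¹, [e], Units.inv_eq_of_mul_eq_one_right ?_⟩
    rw [hre, cliffordProd, List.map_singleton, List.prod_singleton, smul_mul_smul_comm,
      e.toClifford_mul_self, mul_neg, mul_inv_cancel₀ hr, neg_smul, one_smul, neg_neg]
  | one => exact ⟨1, [], (one_smul _ _).symm⟩
  | mul X Y _ _ hX hY =>
    obtain ⟨r, l, hX⟩ := hX
    obtain ⟨s, l', hY⟩ := hY
    exact ⟨r * s, l ++ l', by
      rw [Units.val_mul, hX, hY, smul_mul_smul_comm, cliffordProd_append]⟩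

theorem mul_self_eq_one_of_smul_mem_pinGroup {r : ℝ} {x : CliffordAlgebra Q7} (hx : x ∈ pinGroup Q7)
    (hrx : r • x ∈ pinGroup Q7) : r * r = 1 := by
  have h := pinGroup.star_mul_self_of_mem hrx
  rw [CliffordAlgebra.star_smul, smul_mul_smul_comm, pinGroup.star_mul_self_of_mem hx,
    ← Algebra.algebraMap_eq_smul_one, ← map_one (algebraMap ℝ _)] at h
  exact algebraMap_Q7_injective h

theorem exists_cliffordProd_eq_of_mem_pinGroup {x : CliffordAlgebra Q7} (hx : x ∈ pinGroup Q7) :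
    ∃ l, cliffordProd l = x := by
  obtain ⟨X, hX, rfl⟩ := (pinGroup.mem_iff.1 hx).1
  obtain ⟨r, l, hl⟩ := exists_eq_smul_cliffordProd hX
  change (X : CliffordAlgebra Q7) ∈ _ at hx
  change ∃ l, cliffordProd l = (X : CliffordAlgebra Q7)
  rw [hl] at hx ⊢
  rcases mul_self_eq_one_iff.1
    (mul_self_eq_one_of_smul_mem_pinGroup (cliffordProd_mem_pinGroup l) hx) with rfl | rfl
  · exact ⟨l, (one_smul _ _).symm⟩
  · obtain ⟨e⟩ := (inferInstance : Nonempty ImUnit)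
    exact ⟨e :: e :: l, by
      rw [cliffordProd_cons, cliffordProd_cons, ← mul_assoc, e.toClifford_mul_self, neg_mul,
        one_mul, neg_one_smul]⟩

theorem even_length_of_cliffordProd_mem_even {l : List ImUnit}
    (hl : cliffordProd l ∈ evenOdd Q7 0) : Even l.length := by
  by_contra hodd
  have hmem := cliffordProd_mem_evenOdd l
  rw [ZMod.natCast_eq_one_iff_odd.2 (Nat.not_even_iff_odd.1 hodd)] at hmem
  have hzero : cliffordProd l = 0 :=
    Submodule.disjoint_def.1 (evenOdd_isCompl Q7).disjoint _ hl hmem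
  have : Nontrivial (CliffordAlgebra Q7) := algebraMap_Q7_injective.nontrivial
  have hstar := pinGroup.star_mul_self_of_mem (cliffordProd_mem_pinGroup l)
  rw [hzero, mul_zero] at hstar
  exact zero_ne_one hstar

theorem mem_Spin7_iff {x : CliffordAlgebra Q7} :
    x ∈ Spin7 ↔ ∃ l, Even l.length ∧ cliffordProd l = x := by
  constructor
  · intro hx
    obtain ⟨l, rfl⟩ := exists_cliffordProd_eq_of_mem_pinGroup (spinGroup.mem_pin hx)
    exact ⟨l, even_length_of_cliffordProd_mem_even (spinGroup.mem_even hx), rfl⟩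
  · rintro ⟨l, hl, rfl⟩
    exact cliffordProd_mem_Spin7 hl

/-! ### Faithfulness of the spin representation on `Spin(7)` -/

theorem exists_mul_ι_eq {x : CliffordAlgebra Q7} (hx : x ∈ Spin7) (v : EuclideanSpace ℝ (Fin 7)) :
    ∃ w, x * ι Q7 v = ι Q7 w * x := by
  let X := spinGroup.toUnits (⟨x, hx⟩ : Spin7)
  obtain ⟨w, hw⟩ := spinGroup.conjAct_smul_ι_mem_range_ι (x := X) hx v
  refine ⟨w, ?_⟩
  rw [hw, ConjAct.units_smul_def, ConjAct.ofConjAct_toConjAct]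
  change x * ι Q7 v = X * ι Q7 v * ((X⁻¹ : (CliffordAlgebra Q7)ˣ) : CliffordAlgebra Q7) * X
  rw [Units.inv_mul_cancel_right]
  rfl

theorem basisFun_coord_eq_smul_polarBilin (i : Fin 7) :
    (EuclideanSpace.basisFun (Fin 7) ℝ).toBasis.coord i =
      (-(1 / 2) : ℝ) • Q7.polarBilin (EuclideanSpace.basisFun (Fin 7) ℝ i) := by
  ext1 v
  rw [LinearMap.smul_apply, QuadraticMap.polarBilin_apply_apply, QuadraticMap.polar,
    Q7_apply, Q7_apply, Q7_apply, norm_add_sq_real, Basis.coord_apply,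
    OrthonormalBasis.coe_toBasis_repr_apply, OrthonormalBasis.repr_apply_apply, smul_eq_mul]
  ring

theorem exists_eq_algebraMap_of_forall_commute {x : CliffordAlgebra Q7} (hinv : involute x = x)
    (hcomm : ∀ v, Commute x (ι Q7 v)) : ∃ r : ℝ, x = algebraMap ℝ _ r :=
  exists_eq_algebraMap_of_contractLeft_eq_zero (EuclideanSpace.basisFun (Fin 7) ℝ).toBasis
    fun i => by
      rw [basisFun_coord_eq_smul_polarBilin, map_smul, LinearMap.smul_apply,
        contractLeft_polarBilin, hinv, (hcomm _).eq, sub_self, smul_zero]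

theorem eq_one_of_spinRep_eq_one {x : CliffordAlgebra Q7} (hx : x ∈ Spin7)
    (h : spinRep x = 1) : x = 1 := by
  have hcomm (v : EuclideanSpace ℝ (Fin 7)) : Commute x (ι Q7 v) := by
    obtain ⟨w, hw⟩ := exists_mul_ι_eq hx v
    have hvw : (imEquiv v : Oct) = imEquiv w := by
      simpa [h, spinRep_ι] using LinearMap.congr_fun (congrArg spinRep hw) 1
    rwa [← imEquiv.injective (Subtype.ext hvw)] at hw
  obtain ⟨r, rfl⟩ := exists_eq_algebraMap_of_forall_commute (spinGroup.involute_eq hx) hcomm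
  rw [AlgHom.commutes, ← map_one (algebraMap ℝ (Module.End ℝ Oct))] at h
  rw [FaithfulSMul.algebraMap_injective ℝ (Module.End ℝ Oct) h, map_one]

theorem spinRep_injOn : Set.InjOn spinRep Spin7 := fun x hx y hy h => by
  have hyx : star y * x = 1 :=
    eq_one_of_spinRep_eq_one (mul_mem (spinGroup.star_mem hy) hx) (by
      rw [map_mul, h, ← map_mul, spinGroup.star_mul_self_of_mem hy, map_one])
  calc x = y * star y * x := by rw [spinGroup.mul_star_self_of_mem hy, one_mul]
    _ = y := by rw [mul_assoc, hyx, mul_one]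

/-! ### Spin operators and companions -/

theorem exists_isCompanion_spinRep {x : CliffordAlgebra Q7} (hx : x ∈ Spin7) :
    ∃ g₁ g₃, IsCompanion g₁ g₃ ∧ ∀ a, spinRep x a = g₃ a := by
  obtain ⟨l, -, rfl⟩ := mem_Spin7_iff.1 hx
  exact ⟨_, _, IsCompanion.list_prod l, spinRep_cliffordProd l⟩

theorem IsCompanion.exists_cliffordProd {g₁ g₃ : Oct ≃ₗᵢ[ℝ] Oct} (h : IsCompanion g₁ g₃) :
    ∃ l : List ImUnit, Even l.length ∧ l.length ≤ 8 ∧ ∀ a, spinRep (cliffordProd l) a = g₃ a := by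
  obtain ⟨l, heven, hlen, -, rfl⟩ := h.exists_list
  exact ⟨l, heven, hlen, spinRep_cliffordProd l⟩

theorem IsCompanion.left_apply {g₁ g₃ : Oct ≃ₗᵢ[ℝ] Oct} (h : IsCompanion g₁ g₃) (a : Oct) :
    g₁ a = g₃ a * C (g₃ 1) := by
  have hmul := h.map_mul a 1
  rw [mul_one] at hmul
  rw [hmul, mul_mul_C, g₃.norm_map, norm_one, one_pow, one_smul]

theorem exists_length_le_of_mem_Spin7 {x : CliffordAlgebra Q7} (hx : x ∈ Spin7) :
    ∃ l : List ImUnit, Even l.length ∧ l.length ≤ 8 ∧ cliffordProd l = x := by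
  obtain ⟨g₁, g₃, h, hg₃⟩ := exists_isCompanion_spinRep hx
  obtain ⟨l, heven, hlen, hl⟩ := h.exists_cliffordProd
  exact ⟨l, heven, hlen, spinRep_injOn (cliffordProd_mem_Spin7 heven) hx
    (LinearMap.ext fun a => (hl a).trans (hg₃ a).symm)⟩

/-! ### Compactness of `Spin(7)` -/

instance : IsModuleTopology ℝ (CliffordAlgebra Q7) := ⟨rfl⟩

theorem continuous_ι_mul :
    Continuous fun p : EuclideanSpace ℝ (Fin 7) × CliffordAlgebra Q7 => ι Q7 p.1 * p.2 := by
  have : ContinuousAdd (CliffordAlgebra Q7) := IsModuleTopology.toContinuousAdd ℝ _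
  have hsum : (fun p : EuclideanSpace ℝ (Fin 7) × CliffordAlgebra Q7 => ι Q7 p.1 * p.2) =
      fun p => ∑ i, p.1 i •
        LinearMap.mulLeft ℝ (ι Q7 (EuclideanSpace.basisFun (Fin 7) ℝ i)) p.2 := by
    ext p
    conv_lhs => rw [← (EuclideanSpace.basisFun (Fin 7) ℝ).sum_repr p.1, map_sum, Finset.sum_mul]
    exact Finset.sum_congr rfl fun i _ => by
      rw [map_smul, smul_mul_assoc, LinearMap.mulLeft_apply, EuclideanSpace.basisFun_repr]
  rw [hsum]
  refine continuous_finsetSum _ fun i _ => Continuous.fun_smul ?_ ?_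
  · exact (EuclideanSpace.proj (𝕜 := ℝ) i).continuous.comp continuous_fst
  · exact (IsModuleTopology.continuous_of_linearMap _).comp continuous_snd

theorem image_cliffordProd_length_succ (n : ℕ) :
    cliffordProd '' {l | l.length = n + 1} =
      (fun p : ImUnit × CliffordAlgebra Q7 => p.1.toClifford * p.2) ''
        (Set.univ ×ˢ (cliffordProd '' {l | l.length = n})) := by
  ext x
  constructor
  · rintro ⟨_ | ⟨e, l⟩, hl, rfl⟩
    · cases hl
    · exact ⟨(e, cliffordProd l), ⟨trivial, l, Nat.succ_injective hl, rfl⟩, rfl⟩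
  · rintro ⟨⟨e, -⟩, ⟨-, l, hl, rfl⟩, rfl⟩
    exact ⟨e :: l, congrArg Nat.succ hl, cliffordProd_cons e l⟩

theorem isCompact_image_cliffordProd (n : ℕ) :
    IsCompact (cliffordProd '' {l | l.length = n}) := by
  induction n with
  | zero =>
    simp only [List.length_eq_zero_iff, Set.ofPred_eq_eq_singleton, Set.image_singleton,
      isCompact_singleton]
  | succ n ih =>
    rw [image_cliffordProd_length_succ]
    have hcont : Continuous fun e : ImUnit => imEquiv.symm e :=
      imEquiv.symm.continuous.comp continuous_subtype_val
    exact (isCompact_univ.prod ih).image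
      (continuous_ι_mul.comp (hcont.prodMap continuous_id))

theorem Spin7_eq_biUnion : (Spin7 : Set (CliffordAlgebra Q7)) =
    ⋃ n ∈ {n | Even n ∧ n ≤ 8}, cliffordProd '' {l | l.length = n} := by
  ext x
  simp only [Set.mem_iUnion₂]
  constructor
  · intro hx
    obtain ⟨l, heven, hlen, rfl⟩ := exists_length_le_of_mem_Spin7 hx
    exact ⟨l.length, ⟨heven, hlen⟩, l, rfl, rfl⟩
  · rintro ⟨_, ⟨heven, -⟩, l, rfl, rfl⟩
    exact cliffordProd_mem_Spin7 heven

instance : CompactSpace Spin7 := by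
  refine isCompact_iff_compactSpace.1 ?_
  rw [Spin7_eq_biUnion]
  exact ((Set.finite_Iic 8).subset fun n hn => hn.2).isCompact_biUnion
    fun n _ => isCompact_image_cliffordProd n

/-! ### The isomorphism of `Spin(7)` and `K₁` -/

theorem K1_ext {g h : K1} (H : ∀ b, ((g : GLOct2) • Oct2.mk 0 b).snd =
    ((h : GLOct2) • Oct2.mk 0 b).snd) : g = h := by
  obtain ⟨g₁, g₃, hg, hgeq⟩ := mem_K1_iff.1 g.2
  obtain ⟨h₁, h₃, hh, hheq⟩ := mem_K1_iff.1 h.2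
  obtain rfl : g₃ = h₃ := LinearIsometryEquiv.ext fun b => by simpa [hgeq, hheq] using H b
  exact Subtype.ext (hgeq.trans ((hg.eq_left hh).symm ▸ hheq.symm))

theorem exists_K1_forall_smul_eq (x : Spin7) : ∃ k : K1, ∀ v : Oct2, (k : GLOct2) • v =
    Oct2.mk (spinRep x v.fst * C (spinRep x 1)) (spinRep x v.snd) := by
  obtain ⟨g₁, g₃, h, hg₃⟩ := exists_isCompanion_spinRep x.2
  refine ⟨⟨blockDiag g₁ g₃, mem_K1_iff.2 ⟨g₁, g₃, h, rfl⟩⟩, fun v => ?_⟩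
  rw [hg₃, hg₃, hg₃, ← h.left_apply]
  exact blockDiag_smul _ _ _

/-- The homomorphism `Spin(7) → K₁` that sends `x` to the pair whose second component is the spin
operator of `x`; its first component is forced by `IsCompanion.left_apply`. -/
def toK1 : Spin7 →ₙ* K1 where
  toFun x := (exists_K1_forall_smul_eq x).choose
  map_mul' x y := K1_ext fun b => by
    rw [(exists_K1_forall_smul_eq (x * y)).choose_spec, Subgroup.coe_mul, mul_smul,
      (exists_K1_forall_smul_eq x).choose_spec, (exists_K1_forall_smul_eq y).choose_spec]
    simp only [Oct2.mk_snd, Submonoid.coe_mul, map_mul, Module.End.mul_apply]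

theorem toK1_smul (x : Spin7) (v : Oct2) : (toK1 x : GLOct2) • v =
    Oct2.mk (spinRep x v.fst * C (spinRep x 1)) (spinRep x v.snd) :=
  (exists_K1_forall_smul_eq x).choose_spec v

theorem toK1_bijective : Function.Bijective toK1 := by
  constructor
  · intro x y h
    refine Subtype.ext (spinRep_injOn x.2 y.2 (LinearMap.ext fun b => ?_))
    have := congrArg (fun k : K1 => ((k : GLOct2) • Oct2.mk 0 b).snd) h
    simpa only [toK1_smul, Oct2.mk_snd] using this
  · intro k
    obtain ⟨g₁, g₃, h, hk⟩ := mem_K1_iff.1 k.2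
    obtain ⟨l, heven, -, hl⟩ := h.exists_cliffordProd
    refine ⟨⟨cliffordProd l, cliffordProd_mem_Spin7 heven⟩, K1_ext fun b => ?_⟩
    rw [toK1_smul, hk, blockDiag_smul]
    exact hl b

theorem continuous_spinRep (a : Oct) : Continuous fun x : Spin7 => spinRep x a :=
  (IsModuleTopology.continuous_of_linearMap
    (LinearMap.applyₗ a ∘ₗ spinRep.toLinearMap : CliffordAlgebra Q7 →ₗ[ℝ] Oct)).comp
    continuous_subtype_val

instance : ContinuousMul Oct :=
  ⟨((LinearMap.mul ℝ Oct).mkContinuous₂ 1 fun x y => by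
    rw [LinearMap.mul_apply', norm_mul, one_mul]).continuous₂⟩

theorem continuous_toK1 : Continuous toK1 := by
  refine Continuous.subtype_mk (f := fun x => (toK1 x : GLOct2)) ?_ fun x => (toK1 x).2
  rw [Units.isOpenEmbedding_val.isInducing.continuous_iff, continuous_clm_apply]
  refine fun v => (continuous_congr fun x => toK1_smul x v).2 ?_
  exact (WithLp.prod_continuous_toLp 2 Oct Oct).comp
    (((continuous_spinRep v.fst).mul (C.continuous_of_finiteDimensional.comp
      (continuous_spinRep 1))).prodMk (continuous_spinRep v.snd))

theorem nonempty_K1_equiv_Spin7 : Nonempty (K1 ≃ₜ* Spin7) := by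
  let e : Spin7 ≃* K1 := MulEquiv.ofBijective toK1 toK1_bijective
  have he : Continuous e.toEquiv := continuous_toK1
  let e' : Spin7 ≃ₜ* K1 :=
    { e with
      continuous_toFun := he
      continuous_invFun := he.homeoOfEquivCompactToT2.continuous_symm }
  exact ⟨e'.symm⟩

end Spin7

end SpinNine

end

theorem mainTheorem4 :
    -- `Spin(9) ⊂ SO(16)`
    SpinNine.Spin9 ≤ SpinNine.SO16 ∧
    -- it is transitive on the unit sphere of `O²`
    (∀ v ∈ Metric.sphere (0 : SpinNine.Oct2) 1,
      MulAction.orbit SpinNine.Spin9 v = Metric.sphere (0 : SpinNine.Oct2) 1) ∧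
    -- `q` generates the algebra of invariant polynomials
    SpinNine.invPoly = Algebra.adjoin ℝ {SpinNine.q} ∧
    -- the stabilizer of `(1, 0)` is `K₁`, which is isomorphic to `Spin(7)`
    SpinNine.Spin9 ⊓ MulAction.stabilizer SpinNine.GLOct2
      (SpinNine.Oct2.mk 1 0) = SpinNine.K1 ∧
    Nonempty (SpinNine.K1 ≃ₜ* SpinNine.Spin7) ∧
    -- the generic orbit on `O² ⊕ O²` has codimension 4
    (∃ P ∈ SpinNine.polyFun (SpinNine.Oct2 × SpinNine.Oct2), P ≠ 0 ∧
      ∀ z, P z ≠ 0 →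
        SpinNine.IsSubmanifoldOfCodim 4 (MulAction.orbit SpinNine.Spin9 z)) ∧
    -- the orbits on `O² ⊕ O²` are the joint level sets
    (∀ z : SpinNine.Oct2 × SpinNine.Oct2, MulAction.orbit SpinNine.Spin9 z =
      {w | SpinNine.q20 w = SpinNine.q20 z ∧ SpinNine.q11 w = SpinNine.q11 z ∧
        SpinNine.q02 w = SpinNine.q02 z ∧ SpinNine.q22 w = SpinNine.q22 z}) := by
  refine ⟨SpinNine.Spin9_le_SO16, fun _ => SpinNine.orbit_eq_sphere,
    SpinNine.invPoly_eq_adjoin, SpinNine.stabilizer_eq_K1, SpinNine.nonempty_K1_equiv_Spin7,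
    ⟨SpinNine.disc, SpinNine.disc_mem_polyFun, SpinNine.disc_ne_zero,
      fun _ hz => SpinNine.isSubmanifoldOfCodim_orbit hz⟩, fun z => ?_⟩
  exact (SpinNine.orbit_eq_invariants_preimage z).trans
    (Set.ext fun _ => SpinNine.invariants_eq_iff)
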